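/- Let $N$ be a complex manifold of complex dimension $n$ with a Kähler–Einstein metric $g$, $\mathrm{Ric}(g)=t\,g$ with $t>0$, complex structure $J$ and Kähler form $\omega=g(J\cdot,\cdot)$. Let $\pi\colon K(N)\to N$ be the total space of the canonical bundle $\Lambda^{n,0}T^*N$, with the Hermitian norm for which $\theta_1\wedge\dots\wedge\theta_n$ has length one if $(\theta_j)$ is dual to a unitary frame, and with the connection induced by the Levi-Civita connection of $g$. Let $\rho$ be the tautological $n$-form on $K(N)$, $\rho_p(v_1,\dots,v_n)=p(\pi_*v_1,\dots,\pi_*v_n)$, and let $\varphi=d\rho$. Let $r^2$ be the squared length on $K(N)$, let $u(s)=(ts+c)^{1/(n+1)}$ with a constant $c>0$, and let $$\omega_u=u(r^2)\,\pi^*\omega+i\,t^{-1}u'(r^2)\,b\wedge\bar b$$ be the Kähler form of the Calabi metric, where $b$ is the projection of $TK(N)$ to the vertical space along the horizontal distribution, written in a unitary coordinate of the fibre; thus the horizontal and the vertical distribution are orthogonal. An immersed submanifold of $K(N)$ of real dimension $n+1$ is called special Lagrangian if $\omega_u$ and $\operatorname{Im}\varphi$ restrict to zero on it. Let $\iota\colon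 L\to N$ be a Lagrangian immersion of an oriented smooth $n$-manifold. Then for every $l\in L$ there is a unique $\kappa_l\in K(N)_{\iota(l)}$ which restricts to the volume form of $(L,\iota^*g)$ on $T_lL$. Let $L^K=\{a\kappa_l : l\in L,\ a\in\mathbb R\}\subset K(N)$, parametrized by $L\times\mathbb R$, $(l,a)\mapsto a\kappa_l$; this map is a topological embedding if $\iota$ is one. Then $L$ is minimal, that is, the trace of its second fundamental form vanishes, if and only if $L^K$ is a special Lagrangian immersed submanifold of $K(N)$. -/

import Mathlib

open scoped Manifold ContDiff ComplexConjugate Topology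

set_option maxSynthPendingDepth 3

namespace MinLag

noncomputable section

/-- The model space `ℂⁿ` of a complex `n`-manifold, also used as a real vector space. -/
abbrev Cn (n : ℕ) : Type := EuclideanSpace ℂ (Fin n)

/-- A complex manifold is a real-analytic manifold, with the same charts. -/
instance isManifold_real {n : ℕ} (N : Type*) [TopologicalSpace N] [ChartedSpace (Cn n) N]
    [IsManifold 𝓘(ℂ, Cn n) ω N] : IsManifold 𝓘(ℝ, Cn n) ω N := by
  refine isManifold_of_contDiffOn _ _ _ fun e e' he he' => ?_
  have h := (mem_groupoid_of_pregroupoid.1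
    (HasGroupoid.compatible (G := contDiffGroupoid ω 𝓘(ℂ, Cn n)) he he')).1
  exact ContDiffOn.restrict_scalars ℝ h

/-! ### The canonical bundle -/

/-- The form `dz₁ ∧ … ∧ dzₙ` on `ℂⁿ`, as a complex valued real alternating form. -/
def dzForm (n : ℕ) : Cn n [⋀^Fin n]→L[ℝ] ℂ :=
  { (EuclideanSpace.basisFun (Fin n) ℂ).toBasis.det.restrictScalars ℝ with
    map_eq_zero_of_eq' := fun v i j h hij =>
      (EuclideanSpace.basisFun (Fin n) ℂ).toBasis.det.map_eq_zero_of_eq v h hij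
    cont := by
      change Continuous fun v : Fin n → Cn n => (EuclideanSpace.basisFun (Fin n) ℂ).toBasis.det v
      simp only [Module.Basis.det_apply]
      refine Continuous.matrix_det (continuous_matrix fun i j => ?_)
      simp only [Module.Basis.toMatrix_apply, OrthonormalBasis.coe_toBasis_repr_apply,
        EuclideanSpace.basisFun_repr]
      fun_prop }

variable (n : ℕ) (N : Type*) [TopologicalSpace N] [ChartedSpace (Cn n) N]
  [IsManifold 𝓘(ℂ, Cn n) ω N]

/-- The canonical bundle `Λ^{n,0} T*N` as a holomorphic line bundle given by its transition
functions: over a chart `z` an element is written `y dz₁ ∧ … ∧ dzₙ` with `y : ℂ`, and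
`y' = det (∂z/∂z') y` over another chart `z'`. -/
def canonicalCore : VectorBundleCore ℂ N ℂ (atlas (Cn n) N) where
  baseSet i := i.1.source
  isOpen_baseSet i := i.1.open_source
  indexAt := achart (Cn n)
  mem_baseSet_at := mem_chart_source (Cn n)
  coordChange i j x :=
    ((tangentBundleCore 𝓘(ℂ, Cn n) N).coordChange j i x).det • ContinuousLinearMap.id ℂ ℂ
  coordChange_self i x hx v := by
    have : (tangentBundleCore 𝓘(ℂ, Cn n) N).coordChange i i x = ContinuousLinearMap.id ℂ _ :=
      ContinuousLinearMap.ext fun w => (tangentBundleCore 𝓘(ℂ, Cn n) N).coordChange_self i x hx w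
    rw [this]
    simp [ContinuousLinearMap.det]
  continuousOn_coordChange i j := by
    have h := (tangentBundleCore 𝓘(ℂ, Cn n) N).continuousOn_coordChange j i
    rw [Set.inter_comm] at h
    exact (ContinuousLinearMap.continuous_det.comp_continuousOn h).smul continuousOn_const
  coordChange_comp i j k x hx v := by
    have : (tangentBundleCore 𝓘(ℂ, Cn n) N).coordChange k i x =
        ((tangentBundleCore 𝓘(ℂ, Cn n) N).coordChange j i x).comp
          ((tangentBundleCore 𝓘(ℂ, Cn n) N).coordChange k j x) :=
      ContinuousLinearMap.ext fun w =>
        ((tangentBundleCore 𝓘(ℂ, Cn n) N).coordChange_comp k j i x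
          ⟨⟨hx.2, hx.1.2⟩, hx.1.1⟩ w).symm
    rw [this]
    simp only [ContinuousLinearMap.det, ContinuousLinearMap.toLinearMap_comp, LinearMap.det_comp,
      smul_apply, ContinuousLinearMap.id_apply, smul_eq_mul]
    ring

/-- The fibre `K_x` of the canonical bundle. Like `T_xN`, it is coordinatized by the preferred
chart at `x`: `a : ℂ` stands for the form `a dz₁ ∧ … ∧ dzₙ` in this chart. -/
abbrev CanonicalFiber (x : N) : Type := (canonicalCore n N).Fiber x

/-- The total space `K(N)` of the canonical bundle. -/
abbrev CanonicalBundle : Type _ := Bundle.TotalSpace ℂ (CanonicalFiber n N)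

/-- The model with corners of `K(N)` as a real manifold. -/
abbrev modelK (n : ℕ) : ModelWithCorners ℝ (Cn n × ℂ) (ModelProd (Cn n) ℂ) :=
  𝓘(ℝ, Cn n).prod 𝓘(ℝ, ℂ)

variable {n N}

/-- An element of `K_x`, seen as an alternating `n`-form on `T_xN`. -/
def fiberForm (x : N) (a : CanonicalFiber n N x) : TangentSpace 𝓘(ℝ, Cn n) x [⋀^Fin n]→L[ℝ] ℂ :=
  (show ℂ from a) • dzForm n

/-- The tautological form `ρ` on `K(N)`: `ρ_p (v₁, …, vₙ) = p (π_* v₁, …, π_* vₙ)`. -/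
def tautologicalForm (p : CanonicalBundle n N) : TangentSpace (modelK n) p [⋀^Fin n]→L[ℝ] ℂ :=
  (fiberForm p.proj p.snd).compContinuousLinearMap
    (mfderiv (modelK n) 𝓘(ℝ, Cn n) (Bundle.TotalSpace.proj : CanonicalBundle n N → N) p)

/-- Exterior derivative of a differential form on a manifold without boundary: at `p`, it is the
exterior derivative of the expression of the form in the preferred chart at `p`. -/
def mextDeriv {V H M F : Type*} [NormedAddCommGroup V] [NormedSpace ℝ V] [TopologicalSpace H]
    (I : ModelWithCorners ℝ V H) [I.Boundaryless] [TopologicalSpace M] [ChartedSpace H M]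
    [NormedAddCommGroup F] [NormedSpace ℝ F] {k : ℕ}
    (η : ∀ p : M, TangentSpace I p [⋀^Fin k]→L[ℝ] F) (p : M) :
    TangentSpace I p [⋀^Fin (k + 1)]→L[ℝ] F :=
  extDeriv (E := V) (fun z => (η ((extChartAt I p).symm z)).compContinuousLinearMap
    (mfderiv 𝓘(ℝ, V) I (extChartAt I p).symm z)) (extChartAt I p p)

/-- The holomorphic volume form `φ = dρ` on `K(N)`. -/
def holVolumeForm (p : CanonicalBundle n N) : TangentSpace (modelK n) p [⋀^Fin (n + 1)]→L[ℝ] ℂ :=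
  mextDeriv (modelK n) (tautologicalForm (n := n) (N := N)) p

/-! ### Levi-Civita connection and Ricci curvature of a metric on an open set of a vector space -/

section Chart

variable {V : Type*} [NormedAddCommGroup V] [NormedSpace ℝ V]

/-- Christoffel symbols of the first kind of a metric `G`:
`[v w, y] = (D_v G(w, y) + D_w G(v, y) - D_y G(v, w)) / 2`. -/
def christoffelFirst (G : V → V →L[ℝ] V →L[ℝ] ℝ) (z : V) : V →L[ℝ] V →L[ℝ] V →L[ℝ] ℝ :=
  (2⁻¹ : ℝ) • (fderiv ℝ G z + (fderiv ℝ G z).flip -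
    ((ContinuousLinearMap.flipₗᵢ ℝ V V ℝ).toContinuousLinearEquiv.toContinuousLinearMap.comp
      (fderiv ℝ G z).flip))

/-- Christoffel symbols of a metric `G`: `G (Γ(v, w), y) = [v w, y]` for all `y`. -/
def christoffel (G : V → V →L[ℝ] V →L[ℝ] ℝ) (z : V) : V →L[ℝ] V →L[ℝ] V :=
  (ContinuousLinearMap.compL ℝ V (V →L[ℝ] ℝ) V (G z).inverse).comp (christoffelFirst G z)

/-- The curvature `R(u, v) w` of a metric `G`, as a linear map in `u`. -/
def curvature (G : V → V →L[ℝ] V →L[ℝ] ℝ) (z v w : V) : V →ₗ[ℝ] V where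
  toFun u := fderiv ℝ (christoffel G) z u v w - fderiv ℝ (christoffel G) z v u w
    + christoffel G z u (christoffel G z v w) - christoffel G z v (christoffel G z u w)
  map_add' := by intros; simp; abel
  map_smul' := by intros; simp [smul_sub, smul_add]

/-- The Ricci curvature `Ric(v, w) = tr (u ↦ R(u, v) w)` of a metric `G`. -/
def ricci (G : V → V →L[ℝ] V →L[ℝ] ℝ) (z v w : V) : ℝ :=
  LinearMap.trace ℝ V (curvature G z v w)

end Chart

/-! ### Kähler-Einstein metrics -/

variable (n N) in
/-- Smooth Riemannian metrics on the complex manifold `N`. -/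
abbrev RMetric : Type _ :=
  Bundle.ContMDiffRiemannianMetric 𝓘(ℝ, Cn n) ∞ (Cn n) (fun x : N => TangentSpace 𝓘(ℝ, Cn n) x)

/-- `g_x(v, w)`, with `T_xN` coordinatized by the preferred chart at `x`. -/
def inn (g : RMetric n N) (x : N) : Cn n →L[ℝ] Cn n →L[ℝ] ℝ := g.inner x

/-- The metric `g` in the coordinates of the preferred chart at `x`. -/
def chartMetric (g : RMetric n N) (x : N) (z : Cn n) : Cn n →L[ℝ] Cn n →L[ℝ] ℝ :=
  (inn g ((extChartAt 𝓘(ℝ, Cn n) x).symm z)).bilinearComp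
    (mfderiv 𝓘(ℝ, Cn n) 𝓘(ℝ, Cn n) (extChartAt 𝓘(ℝ, Cn n) x).symm z : Cn n →L[ℝ] Cn n)
    (mfderiv 𝓘(ℝ, Cn n) 𝓘(ℝ, Cn n) (extChartAt 𝓘(ℝ, Cn n) x).symm z : Cn n →L[ℝ] Cn n)

/-- The Christoffel symbols of `g` at `x`, in the preferred chart at `x`. -/
def Gam (g : RMetric n N) (x : N) : Cn n →L[ℝ] Cn n →L[ℝ] Cn n :=
  christoffel (chartMetric g x) (extChartAt 𝓘(ℝ, Cn n) x x)

/-- The Ricci curvature of `g` at `x`. -/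
def ric (g : RMetric n N) (x : N) (v w : Cn n) : ℝ :=
  ricci (chartMetric g x) (extChartAt 𝓘(ℝ, Cn n) x x) v w

/-- The Kähler form `ω(v, w) = g(Jv, w)`. -/
def kahlerForm (g : RMetric n N) (x : N) (v w : Cn n) : ℝ := inn g x (Complex.I • v) w

/-- `g` is a Kähler-Einstein metric with `Ric = t g`. -/
structure IsKahlerEinstein (g : RMetric n N) (t : ℝ) : Prop where
  /-- `g` is Hermitian: the complex structure `J` acts by isometries. -/
  hermitian : ∀ (x : N) (v w : Cn n), inn g x (Complex.I • v) (Complex.I • w) = inn g x v w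
  /-- `dω = 0`, that is `D_u ω(v, w) + D_v ω(w, u) + D_w ω(u, v) = 0` in holomorphic coordinates,
  in which `J` is multiplication by `i`. -/
  closed : ∀ (x : N) (u v w : Cn n),
    fderiv ℝ (chartMetric g x) (extChartAt 𝓘(ℝ, Cn n) x x) u (Complex.I • v) w
      + fderiv ℝ (chartMetric g x) (extChartAt 𝓘(ℝ, Cn n) x x) v (Complex.I • w) u
      + fderiv ℝ (chartMetric g x) (extChartAt 𝓘(ℝ, Cn n) x x) w (Complex.I • u) v = 0
  einstein : ∀ (x : N) (v w : Cn n), ric g x v w = t * inn g x v w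

/-! ### The Calabi metric on the canonical bundle -/

/-- The Hermitian Gram matrix `h(e_i, e_j) = g(e_i, e_j) + i g(e_i, J e_j)` of the coordinate basis
at `x`. -/
def hermGram (g : RMetric n N) (x : N) : Matrix (Fin n) (Fin n) ℂ :=
  Matrix.of fun i j =>
    (inn g x (EuclideanSpace.single i 1) (EuclideanSpace.single j 1) : ℂ)
      + Complex.I * inn g x (EuclideanSpace.single i 1) (Complex.I • EuclideanSpace.single j 1)

/-- The squared norm of `dz₁ ∧ … ∧ dzₙ` at `x`, for the Hermitian norm on the canonical bundle
for which `θ₁ ∧ … ∧ θₙ` has norm one if `θ` is the dual frame of a unitary frame. -/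
def dzNormSq (g : RMetric n N) (x : N) : ℝ := ((hermGram g x).det.re)⁻¹

/-- The Hermitian metric `⟨a, b⟩` on the fibre `K_x`; the form is conjugate linear in `b`. -/
def fiberInner (g : RMetric n N) (x : N) (a b : ℂ) : ℂ := dzNormSq g x * (a * conj b)

/-- The function `r²` on `K(N)`, the squared length. -/
def rSq (g : RMetric n N) (p : CanonicalBundle n N) : ℝ := (fiberInner g p.proj p.snd p.snd).re

/-- The connection form of `K(N)` in the frame `dz₁ ∧ … ∧ dzₙ` of the preferred chart at `x`, that is
`∇_v (dz₁ ∧ … ∧ dzₙ) = (connForm v) dz₁ ∧ … ∧ dzₙ`, where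
`∇_v (dz₁ ∧ … ∧ dzₙ) (e₁, …, eₙ) = - ∑ j, dz₁ ∧ … ∧ dzₙ (e₁, …, Γ(v, e_j), …, eₙ)`. -/
def connForm (g : RMetric n N) (x : N) (v : Cn n) : ℂ :=
  - ∑ j : Fin n, dzForm n (Function.update (fun i => EuclideanSpace.single i (1 : ℂ)) j
      (Gam g x v (EuclideanSpace.single j 1)))

/-- The projection `b` of `T_pK(N)` to the vertical space `K_{π(p)}` along the horizontal
distribution; in coordinates `b = dy + y ψ` where `ψ` is the connection form. -/
def vertPart (g : RMetric n N) (p : CanonicalBundle n N) (X : Cn n × ℂ) : ℂ :=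
  X.2 + (show ℂ from p.snd) * connForm g p.proj X.1

/-- The Riemannian metric on `K(N)` with profile `u`: the horizontal and the vertical distribution
are orthogonal, it is `u(r²) π^*g` on the horizontal one and `t⁻¹ u'(r²)` times the fibre metric on
the vertical one. The fibre metric is `2 Re ⟨ , ⟩`, the one whose Kähler form is `i b ∧ b̄` for
a unitary coordinate. -/
def calabiMetric (g : RMetric n N) (t : ℝ) (u : ℝ → ℝ) (p : CanonicalBundle n N) (X Y : Cn n × ℂ) : ℝ :=
  u (rSq g p) * inn g p.proj X.1 Y.1
    + t⁻¹ * deriv u (rSq g p) * (2 * (fiberInner g p.proj (vertPart g p X) (vertPart g p Y)).re)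

/-- The Kähler form `ω_u(X, Y) = g_u(JX, Y)` on `K(N)`. -/
def calabiForm (g : RMetric n N) (t : ℝ) (u : ℝ → ℝ) (p : CanonicalBundle n N)
    (X Y : TangentSpace (modelK n) p) : ℝ :=
  calabiMetric g t u p (Complex.I • (show Cn n × ℂ from X)) Y

/-- The profile `u(s) = (t s + c)^{1/(n+1)}` of the Calabi metric. -/
def calabiProfile (n : ℕ) (t c : ℝ) (s : ℝ) : ℝ := (t * s + c) ^ ((1 : ℝ) / (n + 1))

/-! ### Submanifolds -/

/-- An immersion `F` of a manifold of dimension `n + 1` in `K(N)` is special Lagrangian for `ω_u` and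
`φ` if `ω_u` and `Im φ` vanish on its tangent spaces. -/
structure IsSpecialLagrangian (g : RMetric n N) (t : ℝ) (u : ℝ → ℝ) {V H P : Type*}
    [NormedAddCommGroup V] [NormedSpace ℝ V] [TopologicalSpace H] (I : ModelWithCorners ℝ V H)
    [TopologicalSpace P] [ChartedSpace H P] (F : P → CanonicalBundle n N) : Prop where
  dim : Module.finrank ℝ V = n + 1
  smooth : ContMDiff I (modelK n) ∞ F
  immersion : ∀ q, Function.Injective (mfderiv I (modelK n) F q)
  lagrangian : ∀ (q : P) (v w : TangentSpace I q),
    calabiForm g t u (F q) (mfderiv I (modelK n) F q v) (mfderiv I (modelK n) F q w) = 0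
  special : ∀ (q : P) (v : Fin (n + 1) → TangentSpace I q),
    (holVolumeForm (F q) fun i => mfderiv I (modelK n) F q (v i)).im = 0

section Lagrangian

variable {L : Type*} [TopologicalSpace L] [ChartedSpace (EuclideanSpace ℝ (Fin n)) L]

/-- The differential of `ι` at `l`. -/
def tmap (ι : L → N) (l : L) : TangentSpace (𝓡 n) l →L[ℝ] Cn n :=
  mfderiv (𝓡 n) 𝓘(ℝ, Cn n) ι l

/-- `ι : L → N` is a Lagrangian immersion of the `n`-manifold `L`. -/
structure IsLagrangian (g : RMetric n N) (ι : L → N) : Prop where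
  smooth : ContMDiff (𝓡 n) 𝓘(ℝ, Cn n) ∞ ι
  immersion : ∀ l : L, Function.Injective (tmap (n := n) ι l)
  lagrangian : ∀ (l : L) (v w : TangentSpace (𝓡 n) l),
    kahlerForm g (ι l) (tmap ι l v) (tmap ι l w) = 0

/-- The frame `v` of `T_lL` is orthonormal for the induced metric `ι^*g`. -/
def IsOrthonormalFrame (g : RMetric n N) (ι : L → N) (l : L)
    (v : Module.Basis (Fin n) ℝ (TangentSpace (𝓡 n) l)) : Prop :=
  ∀ i j, inn g (ι l) (tmap ι l (v i)) (tmap ι l (v j)) = if i = j then 1 else 0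

/-- The covariant derivative `∇_v (ι_* w)` along `ι` at `l`, for `w` extended to a vector field that is
constant in the preferred chart at `l`. -/
def covDerivAlong (g : RMetric n N) (ι : L → N) (l : L) (v w : TangentSpace (𝓡 n) l) : Cn n :=
  fderiv ℝ (fderiv ℝ (writtenInExtChartAt (𝓡 n) 𝓘(ℝ, Cn n) l ι)) (extChartAt (𝓡 n) l l) v w
    + Gam g (ι l) (tmap ι l v) (tmap ι l w)

/-- `ι` is minimal: the trace of the second fundamental form, the normal part of `∇_v (ι_* w)`,
vanishes. -/
def IsMinimal (g : RMetric n N) (ι : L → N) : Prop :=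
  ∀ (l : L) (v : Module.Basis (Fin n) ℝ (TangentSpace (𝓡 n) l)), IsOrthonormalFrame g ι l v →
    ∀ ν : Cn n, (∀ w, inn g (ι l) ν (tmap ι l w) = 0) →
      inn g (ι l) (∑ j, covDerivAlong g ι l (v j) (v j)) ν = 0

/-- The orientation `o` of the tangent spaces of `L` is continuous: it is locally constant in the
local trivializations of the tangent bundle. -/
def IsOrientation [IsManifold (𝓡 n) ∞ L]
    (o : ∀ l : L, Orientation ℝ (TangentSpace (𝓡 n) l) (Fin n)) : Prop :=
  ∀ l₀ : L, ∃ o₀ : Orientation ℝ (EuclideanSpace ℝ (Fin n)) (Fin n), ∀ᶠ l in 𝓝 l₀,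
    ∀ h : l ∈ (trivializationAt (EuclideanSpace ℝ (Fin n)) (TangentSpace (𝓡 n)) l₀).baseSet,
      Orientation.map (Fin n) ((trivializationAt (EuclideanSpace ℝ (Fin n))
        (TangentSpace (𝓡 n)) l₀).continuousLinearEquivAt ℝ l h).toLinearEquiv (o l) = o₀

/-- The element `a` of `K_{ι(l)}` restricts to the volume form of `L` at `l`, the form which is `1` on
positively and `-1` on negatively oriented orthonormal frames. -/
def RestrictsToVolume (g : RMetric n N) (ι : L → N)
    (o : ∀ l : L, Orientation ℝ (TangentSpace (𝓡 n) l) (Fin n)) (l : L)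
    (a : CanonicalFiber n N (ι l)) : Prop :=
  ∀ v : Module.Basis (Fin n) ℝ (TangentSpace (𝓡 n) l), IsOrthonormalFrame g ι l v →
    (v.orientation = o l → fiberForm (ι l) a (fun i => tmap ι l (v i)) = 1) ∧
    (v.orientation ≠ o l → fiberForm (ι l) a (fun i => tmap ι l (v i)) = -1)

/-- The submanifold `L^K = {a κ_l | l ∈ L, a ∈ ℝ}` of `K(N)`, as the image of `L × ℝ`. -/
def coneMap (ι : L → N) (κ : ∀ l, CanonicalFiber n N (ι l)) (q : L × ℝ) : CanonicalBundle n N :=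
  ⟨ι q.1, (q.2 : ℂ) • κ q.1⟩

end Lagrangian

end

end MinLag

open MinLag

/-!
Let `κ` be the section of `ι^*K(N)` restricting to the volume form of `L`. As `κ` takes the real
value `1` on positive orthonormal frames of `L`, differentiating `κ(ι_*v₁, …, ι_*vₙ) ∈ ℝ` shows
that the imaginary part of `∇_u κ / κ` is `-g(H, J ι_*u)`, with `H` the mean curvature vector.
Since `ι` is Lagrangian, the vectors `J ι_*u` span the normal space, so `L` is minimal iff
`∇_u κ / κ` is real for all `u`.

In coordinates `φ = dy ∧ dz₁ ∧ … ∧ dzₙ`, which pulls back to `da ∧ vol_L` on the cone and is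
always real there. The vertical part of the derivative of `(l, a) ↦ a κ_l` in the direction
`(u, s)` is `(s + a ∇_u κ / κ) κ`, and the horizontal part of `ω_u` vanishes on the cone, so `ω_u`
vanishes on it iff the imaginary part of `(s + a ∇_u κ / κ) conj (s' + a ∇_{u'} κ / κ)` does,
which again means that `∇_u κ / κ` is real for all `u`.
-/

namespace MinLag

noncomputable section

open Module Function

/-! ### The form `dz₁ ∧ … ∧ dzₙ` -/

section DzForm

variable {n : ℕ}

theorem dzForm_apply (v : Fin n → Cn n) :
    dzForm n v = (EuclideanSpace.basisFun (Fin n) ℂ).toBasis.det v := rfl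

theorem coe_basisFun_toBasis (ι 𝕜 : Type*) [Fintype ι] [DecidableEq ι] [RCLike 𝕜] :
    ⇑(EuclideanSpace.basisFun ι 𝕜).toBasis = fun i => EuclideanSpace.single i (1 : 𝕜) := by
  ext1 i
  simp

theorem dzForm_single : dzForm n (fun i => EuclideanSpace.single i (1 : ℂ)) = 1 := by
  rw [dzForm_apply, ← coe_basisFun_toBasis, Basis.det_self]

theorem dzForm_map (T : Cn n →ₗ[ℂ] Cn n) (v : Fin n → Cn n) :
    dzForm n (fun i => T (v i)) = LinearMap.det T * dzForm n v :=
  Basis.det_comp _ T v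

theorem dzForm_basis_ne_zero (b : Basis (Fin n) ℂ (Cn n)) : dzForm n b ≠ 0 :=
  (Basis.isUnit_det _ b).ne_zero

theorem dzForm_eq_mul_det (b : Basis (Fin n) ℂ (Cn n)) (v : Fin n → Cn n) :
    dzForm n v = dzForm n b * b.det v :=
  congrArg (· v)
    (AlternatingMap.eq_smul_basis_det b (EuclideanSpace.basisFun (Fin n) ℂ).toBasis.det)

theorem dzForm_update (b : Basis (Fin n) ℂ (Cn n)) (j : Fin n) (x : Cn n) :
    dzForm n (update b j x) = dzForm n b * b.repr x j := by
  rw [dzForm_eq_mul_det b, Basis.det_apply, Basis.toMatrix_update, Basis.toMatrix_self,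
    ← Matrix.cramer_apply, Matrix.cramer_one, Module.End.one_apply]

theorem trace_eq_sum_repr {R ι M : Type*} [CommRing R] [AddCommGroup M] [Module R M] [Fintype ι]
    (b : Basis ι R M) (T : M →ₗ[R] M) : LinearMap.trace R M T = ∑ j, b.repr (T (b j)) j := by
  classical
  simp only [LinearMap.trace_eq_matrix_trace R b, Matrix.trace, Matrix.diag_apply,
    LinearMap.toMatrix_apply]

theorem sum_dzForm_update_single (T : Cn n →ₗ[ℂ] Cn n) :
    ∑ j, dzForm n (update (fun i => EuclideanSpace.single i (1 : ℂ)) j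
      (T (EuclideanSpace.single j 1))) = LinearMap.trace ℂ _ T := by
  simp_rw [trace_eq_sum_repr (EuclideanSpace.basisFun (Fin n) ℂ).toBasis, ← coe_basisFun_toBasis,
    dzForm_update, coe_basisFun_toBasis, dzForm_single, one_mul]

end DzForm

/-! ### Inner products, frames and orientations -/

section InnerProduct

variable {V : Type*} [AddCommGroup V] [Module ℝ V] {ι : Type*} [Fintype ι] [DecidableEq ι]

theorem alternatingMap_apply_eq_det_smul {M : Type*} [AddCommGroup M] [Module ℝ M]
    (v : Basis ι ℝ V) (f : V [⋀^ι]→ₗ[ℝ] M) (w : ι → V) : f w = v.det w • f v := by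
  suffices f = (LinearMap.toSpanSingleton ℝ M (f v)).compAlternatingMap v.det from
    congrArg (· w) this
  refine Basis.ext_alternating v fun i hi => ?_
  let σ : Equiv.Perm ι := Equiv.ofBijective i (Finite.injective_iff_bijective.1 hi)
  change f (v ∘ σ) = v.det (v ∘ σ) • f v
  rw [f.map_perm, v.det.map_perm, v.det_self, smul_assoc, one_smul]

theorem exists_toMatrix_eq_one {B : LinearMap.BilinForm ℝ V} (hB : LinearMap.IsSymm B)
    (hpos : ∀ v, v ≠ 0 → 0 < B v v) (w : Basis ι ℝ V) :
    ∃ v : Basis ι ℝ V, LinearMap.BilinForm.toMatrix v B = 1 := by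
  have : FiniteDimensional ℝ V := w.finiteDimensional_of_finite
  obtain ⟨v₀, hv₀⟩ := LinearMap.BilinForm.exists_orthogonal_basis hB
  let e := (finCongr (finrank_eq_card_basis w)).trans (Fintype.equivFin ι).symm
  let v := v₀.reindex e
  have horth : ∀ i j, i ≠ j → B (v i) (v j) = 0 := fun i j hij => by
    simpa only [v, Basis.reindex_apply, onFun] using hv₀ (e.symm.injective.ne hij)
  have hv : ∀ i, 0 < B (v i) (v i) := fun i => hpos _ (v.ne_zero i)
  refine ⟨v.isUnitSMul fun i => (inv_ne_zero (Real.sqrt_pos.2 (hv i)).ne').isUnit, ?_⟩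
  ext i j
  simp only [LinearMap.BilinForm.toMatrix_apply, Basis.isUnitSMul_apply, map_smul,
    LinearMap.smul_apply, smul_eq_mul, Matrix.one_apply]
  split_ifs with hij
  · subst hij
    rw [← mul_assoc, ← mul_inv, Real.mul_self_sqrt (hv i).le, inv_mul_cancel₀ (hv i).ne']
  · rw [horth i j hij, mul_zero, mul_zero]

theorem det_toMatrix_of_toMatrix_eq_one {B : LinearMap.BilinForm ℝ V} {v : Basis ι ℝ V}
    (hv : LinearMap.BilinForm.toMatrix v B = 1) (w : Basis ι ℝ V) :
    (LinearMap.BilinForm.toMatrix w B).det = v.det w ^ 2 := by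
  rw [← LinearMap.BilinForm.toMatrix_mul_basis_toMatrix v w B, hv, mul_one, Matrix.det_mul,
    Matrix.det_transpose, Basis.det_apply, sq]

open scoped Classical in
/-- The sign of a basis with respect to an orientation; it is the value, on a basis which is
orthonormal for an inner product, of the volume form of that inner product. -/
def orientSign (o : Orientation ℝ V ι) (v : Basis ι ℝ V) : ℝ :=
  if v.orientation = o then 1 else -1

variable (o : Orientation ℝ V ι)

theorem orientSign_of_eq {v : Basis ι ℝ V} (h : v.orientation = o) : orientSign o v = 1 := if_pos h

theorem orientSign_of_ne {v : Basis ι ℝ V} (h : v.orientation ≠ o) : orientSign o v = -1 :=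
  if_neg h

theorem orientSign_ne_zero (v : Basis ι ℝ V) : orientSign o v ≠ 0 := by
  unfold orientSign
  split_ifs <;> norm_num

theorem orientSign_eq_neg {v w : Basis ι ℝ V} (h : v.orientation ≠ w.orientation) :
    orientSign o w = -orientSign o v := by
  rcases eq_or_ne v.orientation o with hv | hv
  · rw [orientSign_of_eq o hv, orientSign_of_ne o fun hw => h (hv.trans hw.symm)]
  · have hw : w.orientation = o := by
      rw [(v.orientation_ne_iff_eq_neg o).1 hv.symm, (v.orientation_ne_iff_eq_neg _).1 h.symm]
    rw [orientSign_of_ne o hv, orientSign_of_eq o hw, neg_neg]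

theorem orientSign_mul_abs_det (v w : Basis ι ℝ V) :
    orientSign o w * |v.det w| = orientSign o v * v.det w := by
  have hdet := v.orientation_eq_iff_det_pos w
  rcases (v.isUnit_det w).ne_zero.lt_or_gt with hneg | hpos
  · rw [abs_of_neg hneg, orientSign_eq_neg o fun h => hneg.not_gt (hdet.1 h), neg_mul_neg]
  · rw [abs_of_pos hpos, orientSign, orientSign, hdet.2 hpos]

end InnerProduct

/-! ### Lagrangian maps into a Hermitian vector space -/

section Hermitian

/-- A continuous bilinear form which is a (real) inner product: symmetric and positive definite. -/
structure IsInnerProduct {W : Type*} [NormedAddCommGroup W] [NormedSpace ℝ W]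
    (B : W →L[ℝ] W →L[ℝ] ℝ) : Prop where
  symm : ∀ v w, B v w = B w v
  pos : ∀ v, v ≠ 0 → 0 < B v v

section Real

variable {V W : Type*} [AddCommGroup V] [Module ℝ V] [NormedAddCommGroup W] [NormedSpace ℝ W]
  {B : W →L[ℝ] W →L[ℝ] ℝ} {ι : Type*}

theorem IsInnerProduct.ext (hB : IsInnerProduct B) {v w : W} (h : ∀ y, B v y = B w y) :
    v = w := by
  by_contra hne
  have hpos := hB.pos (v - w) (sub_ne_zero.2 hne)
  rw [map_sub B, sub_apply, h, sub_self] at hpos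
  exact lt_irrefl _ hpos

theorem IsInnerProduct.isInvertible [FiniteDimensional ℝ W] (hB : IsInnerProduct B) :
    B.IsInvertible := by
  have hinj : Injective (B : W →ₗ[ℝ] (W →L[ℝ] ℝ)) :=
    fun v w h => hB.ext fun y => congrArg (fun φ : W →L[ℝ] ℝ => φ y) h
  have hdim : finrank ℝ W = finrank ℝ (W →L[ℝ] ℝ) := by
    rw [← (LinearMap.toContinuousLinearMap (𝕜 := ℝ) (E := W) (F' := ℝ)).finrank_eq]
    exact Subspace.dual_finrank_eq.symm
  exact ⟨(LinearEquiv.ofInjectiveOfFinrankEq _ hinj hdim).toContinuousLinearEquiv, by ext; rfl⟩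

/-- The pullback `τ^*B` of a bilinear form by a linear map, in the algebraic form for which
Mathlib provides Gram matrices. -/
def pullbackForm (B : W →L[ℝ] W →L[ℝ] ℝ) (τ : V →ₗ[ℝ] W) : LinearMap.BilinForm ℝ V :=
  LinearMap.mk₂ ℝ (fun v w => B (τ v) (τ w)) (by simp) (by simp) (by simp) (by simp)

@[simp]
theorem pullbackForm_apply (B : W →L[ℝ] W →L[ℝ] ℝ) (τ : V →ₗ[ℝ] W) (v w : V) :
    pullbackForm B τ v w = B (τ v) (τ w) := rfl

variable [DecidableEq ι]

/-- The basis `v` is orthonormal for the pullback `τ^*B`. -/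
def IsOrthonormalFor (B : W →L[ℝ] W →L[ℝ] ℝ) (τ : V →ₗ[ℝ] W) (v : Basis ι ℝ V) : Prop :=
  ∀ i j, B (τ (v i)) (τ (v j)) = if i = j then 1 else 0

variable [Fintype ι]

theorem toMatrix_pullbackForm_eq_one_iff {τ : V →ₗ[ℝ] W} {v : Basis ι ℝ V} :
    LinearMap.BilinForm.toMatrix v (pullbackForm B τ) = 1 ↔ IsOrthonormalFor B τ v := by
  simp only [IsOrthonormalFor, ← Matrix.ext_iff, LinearMap.BilinForm.toMatrix_apply,
    pullbackForm_apply, Matrix.one_apply]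

omit [Fintype ι] in
theorem IsInnerProduct.exists_isOrthonormalFor [Finite ι] (hB : IsInnerProduct B) {τ : V →ₗ[ℝ] W}
    (hτ : Injective τ) (w : Basis ι ℝ V) : ∃ v : Basis ι ℝ V, IsOrthonormalFor B τ v := by
  have := Fintype.ofFinite ι
  simp only [← toMatrix_pullbackForm_eq_one_iff]
  exact exists_toMatrix_eq_one ⟨fun v w => hB.symm _ _⟩
    (fun v hv => hB.pos _ ((map_ne_zero_iff τ hτ).2 hv)) w

/-- The Gram determinant of a family of vectors for the pullback `τ^*B`. -/
def gramDet (B : W →L[ℝ] W →L[ℝ] ℝ) (τ : V →ₗ[ℝ] W) (w : ι → V) : ℝ :=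
  (Matrix.of fun i j => B (τ (w i)) (τ (w j))).det

theorem IsOrthonormalFor.gramDet_eq {τ : V →ₗ[ℝ] W} {v : Basis ι ℝ V}
    (hv : IsOrthonormalFor B τ v) (w : Basis ι ℝ V) : gramDet B τ w = v.det w ^ 2 := by
  rw [← det_toMatrix_of_toMatrix_eq_one (toMatrix_pullbackForm_eq_one_iff.2 hv), gramDet]
  congr 1
  ext i j
  simp only [Matrix.of_apply, LinearMap.BilinForm.toMatrix_apply, pullbackForm_apply]

theorem IsInnerProduct.gramDet_pos (hB : IsInnerProduct B) {τ : V →ₗ[ℝ] W} (hτ : Injective τ)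
    (w : Basis ι ℝ V) : 0 < gramDet B τ w := by
  obtain ⟨v, hv⟩ := hB.exists_isOrthonormalFor hτ w
  rw [hv.gramDet_eq]
  have := (v.isUnit_det w).ne_zero
  positivity

end Real

variable {V W : Type*} [AddCommGroup V] [Module ℝ V] [NormedAddCommGroup W] [NormedSpace ℝ W]
  [NormedSpace ℂ W] {B : W →L[ℝ] W →L[ℝ] ℝ}

/-- An inner product on a complex vector space for which multiplication by `i` is an isometry, that
is the real part of a Hermitian inner product. -/
structure IsHermitianInner (B : W →L[ℝ] W →L[ℝ] ℝ) : Prop extends IsInnerProduct B where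
  herm : ∀ v w, B (Complex.I • v) (Complex.I • w) = B v w

theorem IsHermitianInner.I_smul_left (hB : IsHermitianInner B) (v w : W) :
    B (Complex.I • v) w = -B v (Complex.I • w) := by
  have h := hB.herm v (Complex.I • w)
  rw [smul_smul, Complex.I_mul_I, neg_smul, one_smul, map_neg] at h
  linarith

/-- An injective linear map whose image is a Lagrangian subspace, that is isotropic for the Kähler
form `B(J·, ·)` of a Hermitian inner product and of half the dimension. -/
structure IsLagrangianMap (B : W →L[ℝ] W →L[ℝ] ℝ) (τ : V →ₗ[ℝ] W) : Prop
    extends IsHermitianInner B where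
  finrank_eq : finrank ℝ V = finrank ℂ W
  injective : Injective τ
  isotropic : ∀ v w, B (Complex.I • τ v) (τ w) = 0

theorem complex_smul_eq [IsScalarTower ℝ ℂ W] (c : ℂ) (x : W) :
    c • x = c.re • x + c.im • Complex.I • x := by
  conv_lhs => rw [← Complex.re_add_im c]
  rw [add_smul, mul_smul, ← Complex.coe_algebraMap, algebraMap_smul, algebraMap_smul]

theorem apply_complex_smul_left [IsScalarTower ℝ ℂ W] (B : W →L[ℝ] W →L[ℝ] ℝ) (c : ℂ) (x y : W) :
    B (c • x) y = c.re * B x y + c.im * B (Complex.I • x) y := by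
  rw [complex_smul_eq c x]
  simp

namespace IsLagrangianMap

variable {τ : V →ₗ[ℝ] W} {ι : Type*}

theorem isotropic_right (hτ : IsLagrangianMap B τ) (v w : V) : B (τ v) (Complex.I • τ w) = 0 := by
  rw [hτ.symm, hτ.isotropic]

theorem eq_zero_of_add_I_smul_eq_zero (hτ : IsLagrangianMap B τ) {x y : V}
    (h : τ x + Complex.I • τ y = 0) : x = 0 ∧ y = 0 := by
  have hx : τ x = 0 := by
    by_contra hx
    have hB : B (τ x + Complex.I • τ y) (τ x) = 0 := by rw [h, map_zero, zero_apply]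
    rw [map_add, add_apply, hτ.isotropic, add_zero] at hB
    exact (hτ.pos _ hx).ne' hB
  rw [hx, zero_add] at h
  exact ⟨(map_eq_zero_iff τ hτ.injective).1 hx, (map_eq_zero_iff τ hτ.injective).1
    ((smul_eq_zero.1 h).resolve_left Complex.I_ne_zero)⟩

variable [IsScalarTower ℝ ℂ W]

theorem linearIndependent [Finite ι] (hτ : IsLagrangianMap B τ) (v : Basis ι ℝ V) :
    LinearIndependent ℂ fun i => τ (v i) := by
  have := Fintype.ofFinite ι
  rw [Fintype.linearIndependent_iff]
  intro c hc
  have hsplit : τ (∑ i, (c i).re • v i) + Complex.I • τ (∑ i, (c i).im • v i) = 0 := by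
    simp only [map_sum, map_smul, Finset.smul_sum, ← Finset.sum_add_distrib,
      smul_comm Complex.I, ← complex_smul_eq, hc]
  obtain ⟨hre, him⟩ := hτ.eq_zero_of_add_I_smul_eq_zero hsplit
  exact fun i => Complex.ext (Fintype.linearIndependent_iff.1 v.linearIndependent _ hre i)
    (Fintype.linearIndependent_iff.1 v.linearIndependent _ him i)

variable [Fintype ι] [FiniteDimensional ℂ W]

/-- The complex basis of the target of a Lagrangian map which is the image of a real basis of its
source; the real and imaginary parts of components in it are the tangential and normal parts. -/
def basis (hτ : IsLagrangianMap B τ) (v : Basis ι ℝ V) : Basis ι ℂ W :=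
  Basis.mk (hτ.linearIndependent v) ((hτ.linearIndependent v).span_eq_top_of_card_eq_finrank'
    ((finrank_eq_card_basis v).symm.trans hτ.finrank_eq)).ge

@[simp]
theorem coe_basis (hτ : IsLagrangianMap B τ) (v : Basis ι ℝ V) :
    ⇑(hτ.basis v) = fun i => τ (v i) :=
  Basis.coe_mk _ _

variable [DecidableEq ι] {v : Basis ι ℝ V}

theorem repr_re (hτ : IsLagrangianMap B τ) (hv : IsOrthonormalFor B τ v) (x : W) (j : ι) :
    ((hτ.basis v).repr x j).re = B x (τ (v j)) := by
  conv_rhs => rw [← (hτ.basis v).sum_repr x]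
  simp only [map_sum, sum_apply, coe_basis, apply_complex_smul_left, hτ.isotropic, hv _ j,
    mul_ite, mul_one, mul_zero, add_zero, Finset.sum_ite_eq', Finset.mem_univ, if_true]

theorem repr_im (hτ : IsLagrangianMap B τ) (hv : IsOrthonormalFor B τ v) (x : W) (j : ι) :
    ((hτ.basis v).repr x j).im = B x (Complex.I • τ (v j)) := by
  conv_rhs => rw [← (hτ.basis v).sum_repr x]
  simp only [map_sum, sum_apply, coe_basis, apply_complex_smul_left, hτ.isotropic_right, hτ.herm,
    hv _ j, mul_ite, mul_one, mul_zero, zero_add, Finset.sum_ite_eq', Finset.mem_univ, if_true]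

omit [Fintype ι] in
theorem exists_eq_I_smul_of_normal [Finite ι] (hτ : IsLagrangianMap B τ)
    (hv : IsOrthonormalFor B τ v) {ν : W} (hν : ∀ w, B ν (τ w) = 0) :
    ∃ u, ν = Complex.I • τ u := by
  have := Fintype.ofFinite ι
  refine ⟨∑ j, ((hτ.basis v).repr ν j).im • v j, ?_⟩
  conv_lhs => rw [← (hτ.basis v).sum_repr ν]
  simp only [complex_smul_eq ((hτ.basis v).repr ν _), hτ.repr_re hv, hν, zero_smul, zero_add,
    coe_basis, map_sum, map_smul, Finset.smul_sum, smul_comm Complex.I]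

end IsLagrangianMap

end Hermitian

/-! ### The volume form of a Lagrangian subspace as a multiple of `dz₁ ∧ … ∧ dzₙ` -/

section Volume

variable {n : ℕ} {V : Type*} [AddCommGroup V] [Module ℝ V] {B : Cn n →L[ℝ] Cn n →L[ℝ] ℝ}
  {τ : V →ₗ[ℝ] Cn n}

theorem dzForm_comp_eq_det_mul (τ : V →ₗ[ℝ] Cn n) (v : Basis (Fin n) ℝ V) (w : Fin n → V) :
    dzForm n (fun i => τ (w i)) = (v.det w : ℂ) * dzForm n (fun i => τ (v i)) :=
  alternatingMap_apply_eq_det_smul v ((dzForm n).toAlternatingMap.compLinearMap τ) w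

theorem IsLagrangianMap.dzForm_ne_zero (hτ : IsLagrangianMap B τ) (v : Basis (Fin n) ℝ V) :
    dzForm n (fun i => τ (v i)) ≠ 0 := by
  rw [← hτ.coe_basis v]
  exact dzForm_basis_ne_zero _

theorem IsLagrangianMap.exists_volume (hτ : IsLagrangianMap B τ) (o : Orientation ℝ V (Fin n))
    (e : Basis (Fin n) ℝ V) :
    ∃ a : ℂ, ∀ w : Basis (Fin n) ℝ V,
      a * dzForm n (fun i => τ (w i)) = (orientSign o w * √(gramDet B τ w) : ℝ) := by
  obtain ⟨v, hv⟩ := hτ.exists_isOrthonormalFor hτ.injective e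
  refine ⟨orientSign o v / dzForm n (fun i => τ (v i)), fun w => ?_⟩
  rw [hv.gramDet_eq, Real.sqrt_sq_eq_abs, orientSign_mul_abs_det, dzForm_comp_eq_det_mul τ v w]
  have := hτ.dzForm_ne_zero v
  push_cast
  field_simp

end Volume

/-! ### The Levi-Civita connection of a metric on a vector space -/

section Christoffel

variable {V : Type*} [NormedAddCommGroup V] [NormedSpace ℝ V] {G : V → V →L[ℝ] V →L[ℝ] ℝ} {z : V}

theorem fderiv_apply_apply (hd : DifferentiableAt ℝ G z) (u v w : V) :
    fderiv ℝ (fun z' => G z' v w) z u = fderiv ℝ G z u v w := by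
  rw [((hd.hasFDerivAt.clm_apply (hasFDerivAt_const v z)).clm_apply
    (hasFDerivAt_const w z)).fderiv]
  simp

theorem fderiv_metric_symm (hd : DifferentiableAt ℝ G z)
    (hG : ∀ᶠ z' in 𝓝 z, IsInnerProduct (G z')) (u v w : V) :
    fderiv ℝ G z u v w = fderiv ℝ G z u w v := by
  have hsymm : (fun z' => G z' v w) =ᶠ[𝓝 z] fun z' => G z' w v := by
    filter_upwards [hG] with z' h using h.symm v w
  rw [← fderiv_apply_apply hd, ← fderiv_apply_apply hd, hsymm.fderiv_eq]

variable [FiniteDimensional ℝ V]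

theorem inner_christoffel (hB : IsInnerProduct (G z)) (v w y : V) :
    G z (christoffel G z v w) y =
      2⁻¹ * (fderiv ℝ G z v w y + fderiv ℝ G z w v y - fderiv ℝ G z y v w) := by
  have h : G z (christoffel G z v w) = christoffelFirst G z v w :=
    hB.isInvertible.self_apply_inverse _
  rw [h]
  simp [christoffelFirst]

variable (hd : DifferentiableAt ℝ G z) (hG : ∀ᶠ z' in 𝓝 z, IsInnerProduct (G z'))
include hd hG

theorem christoffel_symm (v w : V) : christoffel G z v w = christoffel G z w v := by
  refine hG.self_of_nhds.ext fun y => ?_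
  rw [inner_christoffel hG.self_of_nhds, inner_christoffel hG.self_of_nhds,
    fderiv_metric_symm hd hG y v w]
  ring

theorem fderiv_metric_eq_christoffel (u v w : V) :
    fderiv ℝ G z u v w = G z (christoffel G z u v) w + G z v (christoffel G z u w) := by
  rw [hG.self_of_nhds.symm v, inner_christoffel hG.self_of_nhds,
    inner_christoffel hG.self_of_nhds, fderiv_metric_symm hd hG u w v,
    fderiv_metric_symm hd hG v u w, fderiv_metric_symm hd hG w u v]
  ring

end Christoffel

/-! ### Kähler metrics in holomorphic coordinates -/

section Kahler

variable {W : Type*} [NormedAddCommGroup W] [NormedSpace ℝ W] [NormedSpace ℂ W]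
  {G : W → W →L[ℝ] W →L[ℝ] ℝ} {z : W}

theorem fderiv_metric_I_smul (hd : DifferentiableAt ℝ G z)
    (hG : ∀ᶠ z' in 𝓝 z, IsHermitianInner (G z')) (u v w : W) :
    fderiv ℝ G z u (Complex.I • v) w = -fderiv ℝ G z u v (Complex.I • w) := by
  have hherm : (fun z' => G z' (Complex.I • v) w) =ᶠ[𝓝 z] fun z' => -G z' v (Complex.I • w) := by
    filter_upwards [hG] with z' h using h.I_smul_left v w
  rw [← fderiv_apply_apply hd, ← fderiv_apply_apply hd, hherm.fderiv_eq, fderiv_fun_neg, neg_apply]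

/-- `G` is a Kähler metric at `z` in holomorphic coordinates: Hermitian near `z`, and with Kähler
form closed at `z`. -/
structure IsKahlerAt (G : W → W →L[ℝ] W →L[ℝ] ℝ) (z : W) : Prop where
  differentiableAt : DifferentiableAt ℝ G z
  hermitian : ∀ᶠ z' in 𝓝 z, IsHermitianInner (G z')
  closed : ∀ u v w, fderiv ℝ G z u (Complex.I • v) w + fderiv ℝ G z v (Complex.I • w) u
    + fderiv ℝ G z w (Complex.I • u) v = 0

namespace IsKahlerAt

theorem inner (h : IsKahlerAt G z) : ∀ᶠ z' in 𝓝 z, IsInnerProduct (G z') :=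
  h.hermitian.mono fun _ => IsHermitianInner.toIsInnerProduct

variable [FiniteDimensional ℝ W]

/-- The Levi-Civita connection is complex linear: by the Koszul formula, this is the difference of
the closedness of the Kähler form on `(v, w, y)` and on `(v, iw, iy)`. -/
theorem christoffel_I_smul (h : IsKahlerAt G z) (v w : W) :
    christoffel G z v (Complex.I • w) = Complex.I • christoffel G z v w := by
  have hB := h.hermitian.self_of_nhds
  have hsymm := fderiv_metric_symm h.differentiableAt h.inner
  have hherm := fderiv_metric_I_smul h.differentiableAt h.hermitian
  have hII : ∀ x : W, Complex.I • Complex.I • x = -x := fun x => by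
    rw [smul_smul, Complex.I_mul_I, neg_smul, one_smul]
  refine hB.ext fun y => ?_
  rw [hB.I_smul_left, inner_christoffel hB.toIsInnerProduct, inner_christoffel hB.toIsInnerProduct]
  have hclosed := h.closed v (Complex.I • w) (Complex.I • y)
  have hhermI := hherm (Complex.I • y) v (Complex.I • w)
  simp only [hII, map_neg, neg_apply] at hclosed hhermI
  linarith [h.closed v w y, hherm v w y, hherm y v w, hsymm w (Complex.I • y) v,
    hsymm (Complex.I • w) y v]

variable [IsScalarTower ℝ ℂ W]

/-- The endomorphism `Γ(u, ·)` of a Kähler metric, which is complex linear. -/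
def christoffelEnd (h : IsKahlerAt G z) (u : W) : W →ₗ[ℂ] W where
  toFun := christoffel G z u
  map_add' := map_add _
  map_smul' c v := by
    simp only [complex_smul_eq c, map_add, map_smul, RingHom.id_apply, h.christoffel_I_smul]

@[simp]
theorem christoffelEnd_apply (h : IsKahlerAt G z) (u v : W) :
    h.christoffelEnd u v = christoffel G z u v := rfl

end IsKahlerAt

end Kahler

/-! ### Lagrangian immersions in holomorphic coordinates -/

section CovDeriv

variable {E V : Type*} [NormedAddCommGroup E] [NormedSpace ℝ E] [NormedAddCommGroup V]
  [NormedSpace ℝ V] {G : V → V →L[ℝ] V →L[ℝ] ℝ} {ζ : E → V} {x : E}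

/-- The covariant derivative `∇_v (ζ_* w)` along `ζ`, for a constant vector field `w`. -/
def covDeriv (G : V → V →L[ℝ] V →L[ℝ] ℝ) (ζ : E → V) (x v w : E) : V :=
  fderiv ℝ (fderiv ℝ ζ) x v w + christoffel G (ζ x) (fderiv ℝ ζ x v) (fderiv ℝ ζ x w)

theorem covDeriv_symm [FiniteDimensional ℝ V] (hd : DifferentiableAt ℝ G (ζ x))
    (hG : ∀ᶠ z in 𝓝 (ζ x), IsInnerProduct (G z)) (hζ : ContDiffAt ℝ 2 ζ x) (v w : E) :
    covDeriv G ζ x v w = covDeriv G ζ x w v := by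
  have h2 : IsSymmSndFDerivAt ℝ ζ x :=
    hζ.isSymmSndFDerivAt minSmoothness_of_isRCLikeNormedField.le
  rw [covDeriv, covDeriv, h2.eq, christoffel_symm hd hG]

theorem hasFDerivAt_fderiv_apply (hζ : ContDiffAt ℝ 2 ζ x) (v : E) :
    HasFDerivAt (fun y => fderiv ℝ ζ y v) ((fderiv ℝ (fderiv ℝ ζ) x).flip v) x := by
  have hζ' : DifferentiableAt ℝ (fderiv ℝ ζ) x :=
    (hζ.fderiv_right (m := 1) (by norm_num)).differentiableAt one_ne_zero
  simpa only [ContinuousLinearMap.comp_zero, zero_add] using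
    hζ'.hasFDerivAt.clm_apply (hasFDerivAt_const v x)

end CovDeriv

section LocalLagrangian

variable {E : Type*} [NormedAddCommGroup E] [NormedSpace ℝ E] {W : Type*} [NormedAddCommGroup W]
  [NormedSpace ℝ W] [NormedSpace ℂ W]

/-- `ζ` is, near `x`, a Lagrangian immersion into a complex vector space with a Kähler metric `G`:
a Lagrangian immersion into a Kähler manifold, read in charts. -/
structure IsLocalLagrangian (G : W → W →L[ℝ] W →L[ℝ] ℝ) (ζ : E → W) (x : E) : Prop where
  kahler : IsKahlerAt G (ζ x)
  contDiffAt : ContDiffAt ℝ 2 ζ x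
  lagrangian : ∀ᶠ y in 𝓝 x, IsLagrangianMap (G (ζ y)) (fderiv ℝ ζ y : E →ₗ[ℝ] W)

namespace IsLocalLagrangian

variable {G : W → W →L[ℝ] W →L[ℝ] ℝ} {ζ : E → W} {x : E} [FiniteDimensional ℝ W]
  [IsScalarTower ℝ ℂ W]

/-- The second fundamental form of a Lagrangian immersion, read through `J`, is a symmetric
trilinear form: this is the derivative of the vanishing of `ω(ζ_* v, ζ_* w)`, as `∇J = 0`. -/
theorem inner_covDeriv_comm (h : IsLocalLagrangian G ζ x) (u v w : E) :
    G (ζ x) (covDeriv G ζ x u v) (Complex.I • fderiv ℝ ζ x w) =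
      G (ζ x) (covDeriv G ζ x u w) (Complex.I • fderiv ℝ ζ x v) := by
  have hB := h.kahler.hermitian.self_of_nhds
  have hζ' := hasFDerivAt_fderiv_apply h.contDiffAt
  have hG : HasFDerivAt (fun y => G (ζ y)) ((fderiv ℝ G (ζ x)).comp (fderiv ℝ ζ x)) x :=
    h.kahler.differentiableAt.hasFDerivAt.comp x
      (h.contDiffAt.differentiableAt two_ne_zero).hasFDerivAt
  have hIζ' : HasFDerivAt (fun y => Complex.I • fderiv ℝ ζ y v)
      (Complex.I • (fderiv ℝ (fderiv ℝ ζ) x).flip v) x := (hζ' v).const_smul Complex.I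
  have hω := (hG.clm_apply hIζ').clm_apply (hζ' w)
  have hω0 : (fun y => G (ζ y) (Complex.I • fderiv ℝ ζ y v) (fderiv ℝ ζ y w)) =ᶠ[𝓝 x] 0 := by
    filter_upwards [h.lagrangian] with y hy using hy.isotropic v w
  have hzero := congrArg (fun φ : E →L[ℝ] ℝ => φ u)
    (hω.unique ((hasFDerivAt_const 0 x).congr_of_eventuallyEq hω0))
  simp only [add_apply, ContinuousLinearMap.comp_apply, ContinuousLinearMap.flip_apply, smul_apply,
    zero_apply, fderiv_metric_eq_christoffel h.kahler.differentiableAt h.kahler.inner,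
    h.kahler.christoffel_I_smul] at hzero
  have hcomm : ∀ a : W, G (ζ x) (Complex.I • fderiv ℝ ζ x v) a
      = G (ζ x) a (Complex.I • fderiv ℝ ζ x v) := fun a => hB.symm _ _
  rw [hB.I_smul_left _ (fderiv ℝ ζ x w), hB.I_smul_left _ (fderiv ℝ ζ x w), hcomm, hcomm] at hzero
  simp only [covDeriv, map_add, add_apply]
  linarith

theorem im_sum_repr_covDeriv [FiniteDimensional ℂ W] (h : IsLocalLagrangian G ζ x) {ι : Type*}
    [Fintype ι] [DecidableEq ι] {v : Basis ι ℝ E}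
    (hv : IsOrthonormalFor (G (ζ x)) (fderiv ℝ ζ x : E →ₗ[ℝ] W) v) (u : E) :
    (∑ j, (h.lagrangian.self_of_nhds.basis v).repr (covDeriv G ζ x u (v j)) j).im =
      G (ζ x) (∑ j, covDeriv G ζ x (v j) (v j)) (Complex.I • fderiv ℝ ζ x u) := by
  rw [Complex.im_sum, map_sum, sum_apply]
  refine Finset.sum_congr rfl fun j _ => ?_
  rw [IsLagrangianMap.repr_im _ hv,
    covDeriv_symm h.kahler.differentiableAt h.kahler.inner h.contDiffAt u]
  exact h.inner_covDeriv_comm _ _ _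

end IsLocalLagrangian

end LocalLagrangian

/-! ### The connection form of the volume form of a Lagrangian immersion -/

section Connection

variable {n : ℕ} {E : Type*} [NormedAddCommGroup E] [NormedSpace ℝ E]
  {G : Cn n → Cn n →L[ℝ] Cn n →L[ℝ] ℝ} {ζ : E → Cn n} {x : E}

theorem im_div_eq_zero_of_eventually_real {h : E → ℂ} {h' : E →L[ℝ] ℂ} (hh : HasFDerivAt h h' x)
    (hreal : ∀ᶠ y in 𝓝 x, (h y).im = 0) (u : E) : (h' u / h x).im = 0 := by
  have him : HasFDerivAt (fun y => (h y).im) (Complex.imCLM.comp h') x :=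
    Complex.imCLM.hasFDerivAt.comp x hh
  have hzero : (h' u).im = 0 := congrArg (fun φ : E →L[ℝ] ℝ => φ u)
    (him.unique ((hasFDerivAt_const 0 x).congr_of_eventuallyEq hreal))
  rw [Complex.div_im, hzero, hreal.self_of_nhds]
  simp

theorem hasFDerivAt_dzForm (hζ : ContDiffAt ℝ 2 ζ x) (v : Fin n → E) :
    HasFDerivAt (fun y => dzForm n fun i => fderiv ℝ ζ y (v i))
      (∑ j, ((dzForm n).toContinuousMultilinearMap.toContinuousLinearMap
        (fun i => fderiv ℝ ζ x (v i)) j).comp ((fderiv ℝ (fderiv ℝ ζ) x).flip (v j))) x :=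
  HasFDerivAt.multilinear_comp (dzForm n).toContinuousMultilinearMap fun i =>
    hasFDerivAt_fderiv_apply hζ (v i)

theorem fderiv_dzForm (hζ : ContDiffAt ℝ 2 ζ x) {v : Fin n → E} (b : Basis (Fin n) ℂ (Cn n))
    (hb : ⇑b = fun i => fderiv ℝ ζ x (v i)) (u : E) :
    fderiv ℝ (fun y => dzForm n fun i => fderiv ℝ ζ y (v i)) x u =
      dzForm n b * ∑ j, b.repr (fderiv ℝ (fderiv ℝ ζ) x u (v j)) j := by
  rw [(hasFDerivAt_dzForm hζ v).fderiv, ← hb]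
  simp only [sum_apply, ContinuousLinearMap.comp_apply, ContinuousLinearMap.flip_apply,
    Finset.mul_sum, ← dzForm_update]
  rfl

theorem IsLocalLagrangian.im_logDeriv_sub_trace (h : IsLocalLagrangian G ζ x)
    {v : Basis (Fin n) ℝ E} (hv : IsOrthonormalFor (G (ζ x)) (fderiv ℝ ζ x : E →ₗ[ℝ] Cn n) v)
    {f : E → ℂ} (hf : DifferentiableAt ℝ f x) (hf0 : f x ≠ 0)
    (hreal : ∀ᶠ y in 𝓝 x, (f y * dzForm n fun i => fderiv ℝ ζ y (v i)).im = 0) (u : E) :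
    (fderiv ℝ f x u / f x
      - LinearMap.trace ℂ _ (h.kahler.christoffelEnd (fderiv ℝ ζ x u))).im =
      -G (ζ x) (∑ j, covDeriv G ζ x (v j) (v j)) (Complex.I • fderiv ℝ ζ x u) := by
  set b := h.lagrangian.self_of_nhds.basis v with hb
  have hbv : ⇑b = fun i => fderiv ℝ ζ x (v i) := IsLagrangianMap.coe_basis _ v
  have hD0 : dzForm n b ≠ 0 := dzForm_basis_ne_zero b
  have hderiv := hf.hasFDerivAt.mul (hasFDerivAt_dzForm h.contDiffAt v).differentiableAt.hasFDerivAt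
  have hlog : (fderiv ℝ f x u / f x + ∑ j, b.repr (fderiv ℝ (fderiv ℝ ζ) x u (v j)) j).im = 0 := by
    convert im_div_eq_zero_of_eventually_real hderiv hreal u using 2
    simp only [add_apply, smul_apply, smul_eq_mul, fderiv_dzForm h.contDiffAt b hbv, Pi.mul_apply,
      ← hbv]
    field_simp
    ring
  have hsplit : ∑ j, b.repr (covDeriv G ζ x u (v j)) j =
      ∑ j, b.repr (fderiv ℝ (fderiv ℝ ζ) x u (v j)) j
        + LinearMap.trace ℂ _ (h.kahler.christoffelEnd (fderiv ℝ ζ x u)) := by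
    simp only [trace_eq_sum_repr b, covDeriv, map_add, Finsupp.add_apply, Finset.sum_add_distrib,
      hbv, IsKahlerAt.christoffelEnd_apply]
  rw [← h.im_sum_repr_covDeriv hv, ← hb, hsplit]
  simp only [Complex.add_im, Complex.sub_im] at hlog ⊢
  linarith

end Connection

/-! ### Maps between manifolds in charts -/

section Charts

variable {E H M E' H' M' : Type*} [NormedAddCommGroup E] [NormedSpace ℝ E] [TopologicalSpace H]
  {I : ModelWithCorners ℝ E H} [TopologicalSpace M] [ChartedSpace H M]
  [NormedAddCommGroup E'] [NormedSpace ℝ E'] [TopologicalSpace H'] {I' : ModelWithCorners ℝ E' H'}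
  [TopologicalSpace M'] [ChartedSpace H' M']

theorem extChartAt_symm_mem_chart_source {x : M} {z : E} (hz : z ∈ (extChartAt I x).target) :
    (extChartAt I x).symm z ∈ (chartAt H x).source := by
  simpa only [extChartAt_source] using (extChartAt I x).map_target hz

theorem writtenInExtChartAt_center (f : M → M') (x : M) :
    writtenInExtChartAt I I' x f (extChartAt I x x) = extChartAt I' (f x) (f x) := by
  simp only [writtenInExtChartAt, comp_apply, extChartAt_to_inv]

theorem extChartAt_symm_writtenInExtChartAt {f : M → M'} {x : M} {z : E}
    (hz : f ((extChartAt I x).symm z) ∈ (chartAt H' (f x)).source) :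
    (extChartAt I' (f x)).symm (writtenInExtChartAt I I' x f z) = f ((extChartAt I x).symm z) :=
  (extChartAt I' (f x)).left_inv (by rwa [extChartAt_source])

theorem writtenInExtChartAt_mem_target {f : M → M'} {x : M} {z : E}
    (hz : f ((extChartAt I x).symm z) ∈ (chartAt H' (f x)).source) :
    writtenInExtChartAt I I' x f z ∈ (extChartAt I' (f x)).target :=
  (extChartAt I' (f x)).map_source (by rwa [extChartAt_source])

theorem eventually_mem_chart_source {f : M → M'} {x : M} (hf : ContinuousAt f x) :
    ∀ᶠ z in 𝓝 (extChartAt I x x), f ((extChartAt I x).symm z) ∈ (chartAt H' (f x)).source := by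
  have hφ := (continuousAt_extChartAt_symm (I := I) x).tendsto
  rw [extChartAt_to_inv] at hφ
  exact (hf.tendsto.comp hφ).eventually (chart_source_mem_nhds H' (f x))

variable [I.Boundaryless]

theorem contDiffAt_writtenInExtChartAt {k : ℕ∞ω} {f : M → M'} {x : M}
    (hf : ContMDiffAt I I' k f x) :
    ContDiffAt ℝ k (writtenInExtChartAt I I' x f) (extChartAt I x x) := by
  have h := (contMDiffAt_iff.1 hf).2
  rwa [I.range_eq_univ, contDiffWithinAt_univ] at h

variable [IsManifold I 1 M]

theorem mdifferentiableAt_extChartAt_symm {x : M} {z : E} (hz : z ∈ (extChartAt I x).target) :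
    MDifferentiableAt 𝓘(ℝ, E) I (extChartAt I x).symm z :=
  ((contMDiffOn_extChartAt_symm (n := 1) x).contMDiffAt
    ((isOpen_extChartAt_target x).mem_nhds hz)).mdifferentiableAt one_ne_zero

theorem mfderiv_extChartAt_symm_eq_symmL {x : M} {z : E} (hz : z ∈ (extChartAt I x).target) :
    mfderiv 𝓘(ℝ, E) I (extChartAt I x).symm z =
      (trivializationAt E (TangentSpace I) x).symmL ℝ ((extChartAt I x).symm z) := by
  rw [TangentBundle.symmL_trivializationAt (extChartAt_symm_mem_chart_source hz),
    (extChartAt I x).right_inv hz, I.range_eq_univ, mfderivWithin_univ]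

variable [I'.Boundaryless] [IsManifold I' 1 M']

theorem mfderiv_extChartAt_symm_writtenInExtChartAt {f : M → M'} {x : M} {z : E}
    (hf : MDifferentiableAt I I' f ((extChartAt I x).symm z))
    (hfd : DifferentiableAt ℝ (writtenInExtChartAt I I' x f) z)
    (hz : z ∈ (extChartAt I x).target)
    (hfz : ∀ᶠ z' in 𝓝 z, f ((extChartAt I x).symm z') ∈ (chartAt H' (f x)).source) (v : E) :
    mfderiv 𝓘(ℝ, E') I' (extChartAt I' (f x)).symm (writtenInExtChartAt I I' x f z)
        (fderiv ℝ (writtenInExtChartAt I I' x f) z v) =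
      mfderiv I I' f ((extChartAt I x).symm z) (mfderiv 𝓘(ℝ, E) I (extChartAt I x).symm z v) := by
  have hleft := hf.hasMFDerivAt.comp z (mdifferentiableAt_extChartAt_symm hz).hasMFDerivAt
  have hright := (mdifferentiableAt_extChartAt_symm
    (writtenInExtChartAt_mem_target hfz.self_of_nhds)).hasMFDerivAt.comp z
    hfd.hasFDerivAt.hasMFDerivAt
  have heq : f ∘ (extChartAt I x).symm =ᶠ[𝓝 z]
      (extChartAt I' (f x)).symm ∘ writtenInExtChartAt I I' x f :=
    hfz.mono fun z' hz' => (extChartAt_symm_writtenInExtChartAt hz').symm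
  exact congrArg (fun T : E →L[ℝ] E' => T v)
    (hasMFDerivAt_unique (hright.congr_of_eventuallyEq heq) hleft)

end Charts

/-! ### The metric in holomorphic charts -/

section ChartMetric

variable {n : ℕ} {N : Type*} [TopologicalSpace N] [ChartedSpace (Cn n) N]
  [IsManifold 𝓘(ℂ, Cn n) ω N]

/-- The derivative at `y` of the transition map from the preferred chart at `x` to the preferred
chart at `y`. -/
def chartDeriv (x y : N) : Cn n →L[ℂ] Cn n :=
  (tangentBundleCore 𝓘(ℂ, Cn n) N).coordChange (achart (Cn n) x) (achart (Cn n) y) y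

theorem chartDeriv_self (x : N) : chartDeriv x x = ContinuousLinearMap.id ℂ (Cn n) :=
  ContinuousLinearMap.ext fun v => (tangentBundleCore 𝓘(ℂ, Cn n) N).coordChange_self
    (achart (Cn n) x) x (mem_chart_source (Cn n) x) v

theorem chartDeriv_injective {x y : N} (hy : y ∈ (chartAt (Cn n) x).source) :
    Injective (chartDeriv (n := n) x y) := by
  refine LeftInverse.injective (g := (tangentBundleCore 𝓘(ℂ, Cn n) N).coordChange
    (achart (Cn n) y) (achart (Cn n) x) y) fun v => ?_
  rw [chartDeriv, (tangentBundleCore 𝓘(ℂ, Cn n) N).coordChange_comp (achart (Cn n) x)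
    (achart (Cn n) y) (achart (Cn n) x) y ⟨⟨hy, mem_chart_source (Cn n) y⟩, hy⟩]
  exact (tangentBundleCore 𝓘(ℂ, Cn n) N).coordChange_self (achart (Cn n) x) y hy v

theorem coordChange_eq_restrictScalars {x x' y : N} (hx : y ∈ (chartAt (Cn n) x).source)
    (hx' : y ∈ (chartAt (Cn n) x').source) :
    (tangentBundleCore 𝓘(ℝ, Cn n) N).coordChange (achart (Cn n) x) (achart (Cn n) x') y =
      ((tangentBundleCore 𝓘(ℂ, Cn n) N).coordChange (achart (Cn n) x)
        (achart (Cn n) x') y).restrictScalars ℝ := by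
  have h : ContDiffWithinAt ℂ ω (extChartAt 𝓘(ℂ, Cn n) x' ∘ (extChartAt 𝓘(ℂ, Cn n) x).symm)
      (Set.range 𝓘(ℂ, Cn n)) (extChartAt 𝓘(ℂ, Cn n) x y) :=
    𝓘(ℂ, Cn n).contDiffWithinAt_extendCoordChange' (n := ω)
      (IsManifold.chart_mem_maximalAtlas x) (IsManifold.chart_mem_maximalAtlas x') hx hx'
  rw [modelWithCornersSelf_coe, Set.range_id, contDiffWithinAt_univ] at h
  rw [tangentBundleCore_coordChange_achart, tangentBundleCore_coordChange_achart]
  simp only [modelWithCornersSelf_coe, Set.range_id, fderivWithin_univ]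
  exact (h.differentiableAt (by simp)).fderiv_restrictScalars ℝ

theorem symmL_trivializationAt_eq_chartDeriv {x y : N} (hy : y ∈ (chartAt (Cn n) x).source) :
    ((trivializationAt (Cn n) (TangentSpace 𝓘(ℝ, Cn n)) x).symmL ℝ y : Cn n →L[ℝ] Cn n) =
      (chartDeriv x y).restrictScalars ℝ :=
  (TangentBundle.symmL_trivializationAt_eq_core hy).trans
    (coordChange_eq_restrictScalars hy (mem_chart_source (Cn n) y))

theorem mfderiv_extChartAt_symm {x : N} {z : Cn n} (hz : z ∈ (extChartAt 𝓘(ℝ, Cn n) x).target) :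
    (mfderiv 𝓘(ℝ, Cn n) 𝓘(ℝ, Cn n) (extChartAt 𝓘(ℝ, Cn n) x).symm z : Cn n →L[ℝ] Cn n) =
      (chartDeriv x ((extChartAt 𝓘(ℝ, Cn n) x).symm z)).restrictScalars ℝ := by
  rw [mfderiv_extChartAt_symm_eq_symmL hz]
  exact symmL_trivializationAt_eq_chartDeriv (extChartAt_symm_mem_chart_source hz)

theorem chartMetric_apply (g : RMetric n N) {x : N} {z : Cn n}
    (hz : z ∈ (extChartAt 𝓘(ℝ, Cn n) x).target) (v w : Cn n) :
    chartMetric g x z v w = inn g ((extChartAt 𝓘(ℝ, Cn n) x).symm z)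
      (chartDeriv x ((extChartAt 𝓘(ℝ, Cn n) x).symm z) v)
      (chartDeriv x ((extChartAt 𝓘(ℝ, Cn n) x).symm z) w) := by
  rw [chartMetric, mfderiv_extChartAt_symm hz]
  rfl

theorem chartMetric_center (g : RMetric n N) (x : N) :
    chartMetric g x (extChartAt 𝓘(ℝ, Cn n) x x) = inn g x := by
  ext v w
  rw [chartMetric_apply g (mem_extChartAt_target x), extChartAt_to_inv, chartDeriv_self]
  rfl

theorem isInnerProduct_inn (g : RMetric n N) (x : N) : IsInnerProduct (inn g x) where
  symm := g.symm x
  pos := g.pos x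

theorem isHermitianInner_chartMetric {g : RMetric n N} {x : N} {z : Cn n}
    (hg : IsHermitianInner (inn g ((extChartAt 𝓘(ℝ, Cn n) x).symm z)))
    (hz : z ∈ (extChartAt 𝓘(ℝ, Cn n) x).target) : IsHermitianInner (chartMetric g x z) where
  symm v w := by rw [chartMetric_apply g hz, chartMetric_apply g hz, hg.symm]
  pos v hv := by
    rw [chartMetric_apply g hz]
    refine hg.pos _ fun h => hv ?_
    exact chartDeriv_injective (extChartAt_symm_mem_chart_source hz) (h.trans (map_zero _).symm)
  herm v w := by
    rw [chartMetric_apply g hz, chartMetric_apply g hz, map_smul (chartDeriv _ _),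
      map_smul (chartDeriv _ _), hg.herm]

theorem contMDiffOn_symmL_trivializationAt (x : N) (v : Cn n) :
    ContMDiffOn 𝓘(ℝ, Cn n) (𝓘(ℝ, Cn n).prod 𝓘(ℝ, Cn n)) ∞
      (fun y => Bundle.TotalSpace.mk' (Cn n) (E := fun y : N => TangentSpace 𝓘(ℝ, Cn n) y) y
        ((trivializationAt (Cn n) (TangentSpace 𝓘(ℝ, Cn n)) x).symmL ℝ y v))
      (chartAt (Cn n) x).source := by
  set e := trivializationAt (Cn n) (TangentSpace 𝓘(ℝ, Cn n)) x
  refine ((e.contMDiffOn_symm (n := ∞) (IB := 𝓘(ℝ, Cn n))).comp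
    (contMDiffOn_id.prodMk (contMDiffOn_const (c := v))) fun y hy => ?_).congr fun y hy => ?_
  · exact e.mem_target.2 hy
  · rw [Bundle.Trivialization.symmL_apply _ hy]
    exact e.mk_symm hy v

theorem contDiffOn_chartMetric (g : RMetric n N) (x : N) :
    ContDiffOn ℝ ∞ (chartMetric g x) (extChartAt 𝓘(ℝ, Cn n) x).target := by
  refine contDiffOn_clm_apply.2 fun v => contDiffOn_clm_apply.2 fun w => ?_
  set e := trivializationAt (Cn n) (TangentSpace 𝓘(ℝ, Cn n)) x
  have hbundle : ContMDiffOn 𝓘(ℝ, Cn n) (𝓘(ℝ, Cn n).prod 𝓘(ℝ)) ∞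
      (fun y ↦ Bundle.TotalSpace.mk' ℝ (E := Bundle.Trivial N ℝ) y
        (g.inner y (e.symmL ℝ y v) (e.symmL ℝ y w))) (chartAt (Cn n) x).source :=
    ContMDiffOn.clm_bundle_apply₂ (F₁ := Cn n) (F₂ := Cn n) g.contMDiff.contMDiffOn
      (contMDiffOn_symmL_trivializationAt x v) (contMDiffOn_symmL_trivializationAt x w)
  have hinner : ContMDiffOn 𝓘(ℝ, Cn n) 𝓘(ℝ) ∞
      (fun y => g.inner y (e.symmL ℝ y v) (e.symmL ℝ y w)) (chartAt (Cn n) x).source :=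
    fun y hy => (Bundle.contMDiffWithinAt_totalSpace.1 (hbundle y hy)).2
  have hchart := hinner.comp (contMDiffOn_extChartAt_symm (I := 𝓘(ℝ, Cn n)) x)
    fun z hz => extChartAt_symm_mem_chart_source hz
  refine (contMDiffOn_iff_contDiffOn.1 hchart).congr fun z hz => ?_
  rw [chartMetric_apply g hz, comp_apply]
  exact congrArg (fun T : Cn n →L[ℝ] Cn n => inn g _ (T v) (T w))
    (symmL_trivializationAt_eq_chartDeriv (extChartAt_symm_mem_chart_source hz)).symm

/-- `g` is a Kähler metric; this is `IsKahlerEinstein` without the Einstein equation. -/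
structure IsKahler (g : RMetric n N) : Prop where
  hermitian : ∀ (x : N) (v w : Cn n), inn g x (Complex.I • v) (Complex.I • w) = inn g x v w
  closed : ∀ (x : N) (u v w : Cn n),
    fderiv ℝ (chartMetric g x) (extChartAt 𝓘(ℝ, Cn n) x x) u (Complex.I • v) w
      + fderiv ℝ (chartMetric g x) (extChartAt 𝓘(ℝ, Cn n) x x) v (Complex.I • w) u
      + fderiv ℝ (chartMetric g x) (extChartAt 𝓘(ℝ, Cn n) x x) w (Complex.I • u) v = 0

variable {g : RMetric n N}

theorem IsKahlerEinstein.isKahler {t : ℝ} (hg : IsKahlerEinstein g t) : IsKahler g where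
  hermitian := hg.hermitian
  closed := hg.closed

theorem IsKahler.isHermitianInner (hg : IsKahler g) (x : N) : IsHermitianInner (inn g x) where
  toIsInnerProduct := isInnerProduct_inn g x
  herm := hg.hermitian x

theorem IsKahler.isKahlerAt (hg : IsKahler g) (x : N) :
    IsKahlerAt (chartMetric g x) (extChartAt 𝓘(ℝ, Cn n) x x) where
  differentiableAt := ((contDiffOn_chartMetric g x).contDiffAt
    (extChartAt_target_mem_nhds x)).differentiableAt (by simp)
  hermitian := Filter.Eventually.mono (extChartAt_target_mem_nhds (I := 𝓘(ℝ, Cn n)) x)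
    fun _ hz => isHermitianInner_chartMetric (hg.isHermitianInner _) hz
  closed := hg.closed x

end ChartMetric

/-! ### Lagrangian immersions in charts -/

section Immersion

variable {n : ℕ} {N : Type*} [TopologicalSpace N] [ChartedSpace (Cn n) N]
  {L : Type*} [TopologicalSpace L] [ChartedSpace (EuclideanSpace ℝ (Fin n)) L]

/-- The map `ι` in the preferred charts at `l` and `ι l`. -/
abbrev localRep (ι : L → N) (l : L) : EuclideanSpace ℝ (Fin n) → Cn n :=
  writtenInExtChartAt (𝓡 n) 𝓘(ℝ, Cn n) l ι

theorem tmap_eq_fderiv {ι : L → N} {l : L} (hι : MDifferentiableAt (𝓡 n) 𝓘(ℝ, Cn n) ι l) :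
    tmap (n := n) ι l = fderiv ℝ (localRep (n := n) ι l) (extChartAt (𝓡 n) l l) := by
  rw [tmap, hι.mfderiv, modelWithCornersSelf_coe, Set.range_id, fderivWithin_univ]

variable [IsManifold 𝓘(ℂ, Cn n) ω N]

theorem isLagrangianMap_tmap {g : RMetric n N} {ι : L → N} (hι : IsLagrangian g ι) {l : L}
    (hg : IsHermitianInner (inn g (ι l))) :
    IsLagrangianMap (inn g (ι l)) (tmap (n := n) ι l).toLinearMap where
  toIsHermitianInner := hg
  finrank_eq := finrank_euclideanSpace_fin.trans finrank_euclideanSpace_fin.symm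
  injective := hι.immersion l
  isotropic := hι.lagrangian l

theorem chartMetric_localRep (g : RMetric n N) {ι : L → N} {l : L} {x : EuclideanSpace ℝ (Fin n)}
    (hx : ι ((extChartAt (𝓡 n) l).symm x) ∈ (chartAt (Cn n) (ι l)).source) (v w : Cn n) :
    chartMetric g (ι l) (localRep (n := n) ι l x) v w = inn g (ι ((extChartAt (𝓡 n) l).symm x))
      (chartDeriv (ι l) (ι ((extChartAt (𝓡 n) l).symm x)) v)
      (chartDeriv (ι l) (ι ((extChartAt (𝓡 n) l).symm x)) w) := by
  rw [chartMetric_apply g (writtenInExtChartAt_mem_target hx),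
    extChartAt_symm_writtenInExtChartAt hx]

variable [IsManifold (𝓡 n) ∞ L]

theorem chartDeriv_fderiv_localRep {ι : L → N} (hι : ContMDiff (𝓡 n) 𝓘(ℝ, Cn n) ∞ ι) (l : L) :
    ∀ᶠ x in 𝓝 (extChartAt (𝓡 n) l l), ∀ v : EuclideanSpace ℝ (Fin n),
      chartDeriv (n := n) (ι l) (ι ((extChartAt (𝓡 n) l).symm x))
          (fderiv ℝ (localRep (n := n) ι l) x v) =
        tmap (n := n) ι ((extChartAt (𝓡 n) l).symm x)
          ((trivializationAt (EuclideanSpace ℝ (Fin n)) (TangentSpace (𝓡 n)) l).symmL ℝ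
            ((extChartAt (𝓡 n) l).symm x) v) := by
  have : IsManifold (𝓡 n) 1 L := .of_le (n := ∞) (by simp)
  have : IsManifold 𝓘(ℝ, Cn n) 1 N := .of_le (n := ω) le_top
  have hsmooth : ContDiffAt ℝ 1 (localRep (n := n) ι l) (extChartAt (𝓡 n) l l) :=
    contDiffAt_writtenInExtChartAt ((hι l).of_le (by simp))
  have hchart := (eventually_mem_chart_source (I := 𝓡 n) (H' := Cn n) (hι l).continuousAt)
  filter_upwards [extChartAt_target_mem_nhds (I := 𝓡 n) l, hsmooth.eventually (by simp),
    hchart.eventually_nhds] with x hxt hx hxs v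
  have h := mfderiv_extChartAt_symm_writtenInExtChartAt ((hι _).mdifferentiableAt (by simp))
    (hx.differentiableAt one_ne_zero) hxt hxs v
  rw [mfderiv_extChartAt_symm_eq_symmL hxt, mfderiv_extChartAt_symm (writtenInExtChartAt_mem_target
    hxs.self_of_nhds), extChartAt_symm_writtenInExtChartAt hxs.self_of_nhds] at h
  exact h

theorem isLocalLagrangian_localRep {g : RMetric n N} (hg : IsKahler g) {ι : L → N}
    (hι : IsLagrangian g ι) (l : L) :
    IsLocalLagrangian (chartMetric g (ι l)) (localRep (n := n) ι l) (extChartAt (𝓡 n) l l) where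
  kahler := by
    rw [localRep, writtenInExtChartAt_center]
    exact hg.isKahlerAt (ι l)
  contDiffAt := (contDiffAt_writtenInExtChartAt (hι.smooth l)).of_le ENat.LEInfty.out
  lagrangian := by
    filter_upwards [extChartAt_target_mem_nhds (I := 𝓡 n) l,
      eventually_mem_chart_source (I := 𝓡 n) (H' := Cn n) (hι.smooth l).continuousAt,
      chartDeriv_fderiv_localRep hι.smooth l] with x hxt hxs hx
    have hcomp : chartDeriv (n := n) (ι l) (ι ((extChartAt (𝓡 n) l).symm x)) ∘
        fderiv ℝ (localRep (n := n) ι l) x = _ := funext hx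
    have hsymmL := LeftInverse.injective
      (Bundle.Trivialization.continuousLinearMapAt_symmL (R := ℝ)
        (trivializationAt (EuclideanSpace ℝ (Fin n)) (TangentSpace (𝓡 n)) l)
        (extChartAt_symm_mem_chart_source hxt))
    refine ⟨isHermitianInner_chartMetric (hg.isHermitianInner _)
      (writtenInExtChartAt_mem_target hxs),
      finrank_euclideanSpace_fin.trans finrank_euclideanSpace_fin.symm, ?_, fun v w => ?_⟩
    · refine Injective.of_comp (f := chartDeriv (ι l) (ι ((extChartAt (𝓡 n) l).symm x))) ?_
      exact hcomp ▸ (hι.immersion _).comp hsymmL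
    · rw [chartMetric_localRep g hxs, map_smul (chartDeriv _ _)]
      exact (congrArg₂ (fun a b => inn g _ (Complex.I • a) b) (hx v) (hx w)).trans
        (hι.lagrangian _ _ _)

end Immersion

section Frames

variable {ι V V' W : Type*} [Fintype ι] [DecidableEq ι] [AddCommGroup V] [Module ℝ V]
  [AddCommGroup V'] [Module ℝ V']

theorem orientSign_map_symm (P : V' ≃ₗ[ℝ] V) (o : Orientation ℝ V' ι) (v : Basis ι ℝ V) :
    orientSign o (v.map P.symm) = orientSign (Orientation.map ι P o) v := by
  have h : (v.map P.symm).orientation = o ↔ v.orientation = Orientation.map ι P o := by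
    rw [Basis.orientation_map, ← Orientation.map_symm, Equiv.symm_apply_eq]
  by_cases hv : v.orientation = Orientation.map ι P o
  · rw [orientSign_of_eq o (h.2 hv), orientSign_of_eq _ hv]
  · rw [orientSign_of_ne o (h.not.2 hv), orientSign_of_ne _ hv]

variable [NormedAddCommGroup W] [NormedSpace ℝ W]

theorem gramDet_congr {B B' : W →L[ℝ] W →L[ℝ] ℝ} {τ : V →ₗ[ℝ] W} {τ' : V' →ₗ[ℝ] W} {v : ι → V}
    {v' : ι → V'} (h : ∀ i j, B (τ (v i)) (τ (v j)) = B' (τ' (v' i)) (τ' (v' j))) :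
    gramDet B τ v = gramDet B' τ' v' := by
  simp only [gramDet, h]

end Frames

section Smooth

variable {ι E V W : Type*} [Fintype ι] [DecidableEq ι] [NormedAddCommGroup E] [NormedSpace ℝ E]
  [NormedAddCommGroup V] [NormedSpace ℝ V] [NormedAddCommGroup W] [NormedSpace ℝ W]

theorem contDiffAt_gramDet {k : ℕ∞ω} {B : E → W →L[ℝ] W →L[ℝ] ℝ} {T : E → V →L[ℝ] W} {x : E}
    (hB : ContDiffAt ℝ k B x) (hT : ContDiffAt ℝ k T x) (v : ι → V) :
    ContDiffAt ℝ k (fun y => gramDet (B y) (T y).toLinearMap v) x := by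
  have hTv : ∀ i, ContDiffAt ℝ k (fun y => T y (v i)) x := fun i => hT.clm_apply contDiffAt_const
  simp only [gramDet, Matrix.det_apply]
  exact ContDiffAt.sum fun σ _ => ContDiffAt.const_smul _ <| contDiffAt_prod fun i _ =>
    (hB.clm_apply (hTv _)).clm_apply (hTv i)

theorem contDiffAt_dzForm {n : ℕ} {k : ℕ∞ω} {T : E → V →L[ℝ] Cn n} {x : E}
    (hT : ContDiffAt ℝ k T x) (v : Fin n → V) :
    ContDiffAt ℝ k (fun y => dzForm n fun i => T y (v i)) x :=
  (dzForm n).toContinuousMultilinearMap.contDiff.contDiffAt.comp x <| contDiffAt_pi.2 fun _ =>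
    hT.clm_apply contDiffAt_const

end Smooth

/-! ### The volume form of a Lagrangian immersion -/

section VolumeSection

variable {n : ℕ} {N : Type*} [TopologicalSpace N] [ChartedSpace (Cn n) N]
  [IsManifold 𝓘(ℂ, Cn n) ω N]

/-- The coefficient of `dz₁ ∧ … ∧ dzₙ` in an element of `K_x`. It makes the complex numbers that
represent elements of different fibres terms of the same type. -/
def fiberCoeff {x : N} (a : CanonicalFiber n N x) : ℂ := a

theorem fiberForm_apply {x : N} (a : CanonicalFiber n N x) (v : Fin n → Cn n) :
    fiberForm x a v = fiberCoeff a * dzForm n v := rfl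

theorem trivializationAt_canonical (x : N) (p : CanonicalBundle n N) :
    trivializationAt ℂ (CanonicalFiber n N) x p =
      (p.proj, (chartDeriv (n := n) x p.proj).det * fiberCoeff p.snd) := rfl

section FiberCoord

variable {L : Type*} {ι : L → N} {κ : ∀ l, CanonicalFiber n N (ι l)}

/-- The fibre coordinate of a section `κ` of `K(N)` along `ι`, in the trivialization over the
preferred chart at `ι l`. -/
def fiberCoord (ι : L → N) (κ : ∀ l, CanonicalFiber n N (ι l)) (l l' : L) : ℂ :=
  (trivializationAt ℂ (CanonicalFiber n N) (ι l) ⟨ι l', κ l'⟩).2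

theorem fiberCoord_eq (l l' : L) :
    fiberCoord ι κ l l' = (chartDeriv (n := n) (ι l) (ι l')).det * fiberCoeff (κ l') := rfl

theorem fiberCoord_self (l : L) : fiberCoord ι κ l l = fiberCoeff (κ l) := by
  rw [fiberCoord_eq, chartDeriv_self, ContinuousLinearMap.det, ContinuousLinearMap.coe_id,
    LinearMap.det_id, one_mul]

end FiberCoord

variable {L : Type*} [TopologicalSpace L] [ChartedSpace (EuclideanSpace ℝ (Fin n)) L]

/-- `κ` restricts on each tangent space of `L` to the volume form. In contrast to
`RestrictsToVolume`, this gives the value of the form on all frames and not only on orthonormal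
ones. -/
def IsVolumeSection (g : RMetric n N) (ι : L → N)
    (o : ∀ l : L, Orientation ℝ (TangentSpace (𝓡 n) l) (Fin n))
    (κ : ∀ l, CanonicalFiber n N (ι l)) : Prop :=
  ∀ (l : L) (w : Basis (Fin n) ℝ (TangentSpace (𝓡 n) l)),
    fiberCoeff (κ l) * dzForm n (fun i => tmap ι l (w i)) =
      (orientSign (o l) w * √(gramDet (inn g (ι l)) (tmap (n := n) ι l).toLinearMap w) : ℝ)

variable {g : RMetric n N} {ι : L → N}
  {o : ∀ l : L, Orientation ℝ (TangentSpace (𝓡 n) l) (Fin n)}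
  {κ : ∀ l, CanonicalFiber n N (ι l)}

theorem exists_isOrthonormalFrame (hι : IsLagrangian g ι) (l : L) :
    ∃ v, IsOrthonormalFrame g ι l v :=
  (isInnerProduct_inn g (ι l)).exists_isOrthonormalFor (hι.immersion l)
    (EuclideanSpace.basisFun (Fin n) ℝ).toBasis

theorem restrictsToVolume_iff_forall {l : L} {a : CanonicalFiber n N (ι l)} :
    RestrictsToVolume g ι o l a ↔ ∀ v, IsOrthonormalFrame g ι l v →
      fiberForm (ι l) a (fun i => tmap ι l (v i)) = orientSign (o l) v := by
  refine forall₂_congr fun v _ => ?_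
  by_cases h : v.orientation = o l
  · simp only [h, orientSign_of_eq _ h, Complex.ofReal_one, forall_const, ne_eq, not_true_eq_false,
      IsEmpty.forall_iff, and_true]
  · simp only [h, orientSign_of_ne _ h, Complex.ofReal_neg, Complex.ofReal_one, forall_const, ne_eq,
      not_false_eq_true, IsEmpty.forall_iff, true_and]

theorem IsVolumeSection.fiberForm_eq (hκ : IsVolumeSection g ι o κ) {l : L}
    {v : Basis (Fin n) ℝ (TangentSpace (𝓡 n) l)} (hv : IsOrthonormalFrame g ι l v) :
    fiberForm (ι l) (κ l) (fun i => tmap ι l (v i)) = orientSign (o l) v := by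
  have hgram : gramDet (inn g (ι l)) (tmap (n := n) ι l).toLinearMap v = 1 := by
    rw [IsOrthonormalFor.gramDet_eq hv, v.det_self, one_pow]
  rw [fiberForm_apply, hκ l v, hgram, Real.sqrt_one, mul_one]

section Hermitian

variable (hg : ∀ l, IsHermitianInner (inn g (ι l))) (hι : IsLagrangian g ι)

include hg hι

variable (o) in
theorem exists_isVolumeSection : ∃ κ : ∀ l, CanonicalFiber n N (ι l), IsVolumeSection g ι o κ := by
  choose κ hκ using fun l => (isLagrangianMap_tmap hι (hg l)).exists_volume (o l)
    (EuclideanSpace.basisFun (Fin n) ℝ).toBasis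
  exact ⟨κ, hκ⟩

theorem restrictsToVolume_iff (hκ : IsVolumeSection g ι o κ) (l : L)
    (a : CanonicalFiber n N (ι l)) : RestrictsToVolume g ι o l a ↔ a = κ l := by
  rw [restrictsToVolume_iff_forall]
  refine ⟨fun ha => ?_, fun h v hv => h ▸ hκ.fiberForm_eq hv⟩
  obtain ⟨v, hv⟩ := exists_isOrthonormalFrame hι l
  exact mul_right_cancel₀ (M₀ := ℂ) ((isLagrangianMap_tmap hι (hg l)).dzForm_ne_zero v)
    ((ha v hv).trans (hκ.fiberForm_eq hv).symm)

end Hermitian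

theorem IsVolumeSection.ne_zero (hκ : IsVolumeSection g ι o κ) (hι : IsLagrangian g ι) (l : L) :
    fiberCoeff (κ l) ≠ 0 := by
  obtain ⟨v, hv⟩ := exists_isOrthonormalFrame hι l
  have hne : fiberCoeff (κ l) * dzForm n (fun i => tmap ι l (v i)) ≠ 0 := by
    rw [← fiberForm_apply, hκ.fiberForm_eq hv]
    exact Complex.ofReal_ne_zero.2 (orientSign_ne_zero (o l) v)
  exact left_ne_zero_of_mul hne

theorem IsVolumeSection.fiberCoord_mul_dzForm (hκ : IsVolumeSection g ι o κ) {l l' : L}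
    {v : Fin n → Cn n} {w : Basis (Fin n) ℝ (TangentSpace (𝓡 n) l')}
    (hv : ∀ i, chartDeriv (n := n) (ι l) (ι l') (v i) = tmap ι l' (w i)) :
    fiberCoord ι κ l l' * dzForm n v =
      (orientSign (o l') w * √(gramDet (inn g (ι l')) (tmap (n := n) ι l').toLinearMap w) : ℝ) := by
  have hdet : dzForm n (fun i => tmap ι l' (w i)) =
      (chartDeriv (n := n) (ι l) (ι l')).det * dzForm n v := by
    rw [← funext hv]
    exact dzForm_map (chartDeriv (n := n) (ι l) (ι l')).toLinearMap v
  rw [← hκ l' w, hdet, fiberCoord_eq]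
  ring

variable [IsManifold (𝓡 n) ∞ L]

/-- The fibre coordinate of `κ` near `l`, as a function on the preferred chart at `l`. -/
abbrev localFiberCoord (ι : L → N) (κ : ∀ l, CanonicalFiber n N (ι l)) (l : L)
    (x : EuclideanSpace ℝ (Fin n)) : ℂ :=
  fiberCoord ι κ l ((extChartAt (𝓡 n) l).symm x)

theorem IsVolumeSection.localFiberCoord_mul_dzForm (hκ : IsVolumeSection g ι o κ)
    (hι : IsLagrangian g ι) (ho : IsOrientation o) (l : L)
    (v : Basis (Fin n) ℝ (EuclideanSpace ℝ (Fin n))) :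
    ∃ s : ℝ, ∀ᶠ x in 𝓝 (extChartAt (𝓡 n) l l),
      localFiberCoord ι κ l x * dzForm n (fun i => fderiv ℝ (localRep (n := n) ι l) x (v i)) =
        (s * √(gramDet (chartMetric g (ι l) (localRep (n := n) ι l x))
          (fderiv ℝ (localRep (n := n) ι l) x).toLinearMap v) : ℝ) := by
  obtain ⟨o₀, ho₀⟩ := ho l
  refine ⟨orientSign o₀ v, ?_⟩
  have hφ := (continuousAt_extChartAt_symm (I := 𝓡 n) l).tendsto
  rw [extChartAt_to_inv] at hφ
  filter_upwards [extChartAt_target_mem_nhds (I := 𝓡 n) l,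
    eventually_mem_chart_source (I := 𝓡 n) (H' := Cn n) (hι.smooth l).continuousAt,
    chartDeriv_fderiv_localRep hι.smooth l, hφ.eventually ho₀] with x hxt hxs hx hxo
  have hbase := extChartAt_symm_mem_chart_source hxt
  let P := ((trivializationAt (EuclideanSpace ℝ (Fin n))
    (TangentSpace (𝓡 n)) l).continuousLinearEquivAt ℝ _ hbase).toLinearEquiv
  have hframe : ∀ i, chartDeriv (n := n) (ι l) (ι ((extChartAt (𝓡 n) l).symm x))
      (fderiv ℝ (localRep (n := n) ι l) x (v i)) = tmap (n := n) ι _ (v.map P.symm i) := fun i => by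
    rw [hx, ← Bundle.Trivialization.symm_continuousLinearEquivAt_eq _ hbase]
    rfl
  have hgram : gramDet (chartMetric g (ι l) (localRep (n := n) ι l x))
      (fderiv ℝ (localRep (n := n) ι l) x).toLinearMap v =
      gramDet (inn g (ι ((extChartAt (𝓡 n) l).symm x))) (tmap (n := n) ι _).toLinearMap
        (v.map P.symm) := gramDet_congr fun i j => by
    refine (chartMetric_localRep g hxs _ _).trans ?_
    exact congrArg₂ (fun a b => inn g _ a b) (hframe i) (hframe j)
  rw [hgram, hκ.fiberCoord_mul_dzForm hframe, orientSign_map_symm P, hxo hbase]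

theorem IsVolumeSection.contDiffAt_localFiberCoord (hκ : IsVolumeSection g ι o κ)
    (hι : IsLagrangian g ι) (ho : IsOrientation o) {l : L}
    (hg : IsHermitianInner (inn g (ι l))) :
    ContDiffAt ℝ ∞ (localFiberCoord (n := n) ι κ l) (extChartAt (𝓡 n) l l) := by
  set x₀ := extChartAt (𝓡 n) l l
  set v := (EuclideanSpace.basisFun (Fin n) ℝ).toBasis
  obtain ⟨s, hs⟩ := hκ.localFiberCoord_mul_dzForm hι ho l v
  have hrep : ContDiffAt ℝ ∞ (localRep (n := n) ι l) x₀ :=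
    contDiffAt_writtenInExtChartAt (hι.smooth l)
  have hrep' : ContDiffAt ℝ ∞ (fderiv ℝ (localRep (n := n) ι l)) x₀ :=
    hrep.fderiv_right (by simp)
  have hmetric : ContDiffAt ℝ ∞ (fun x => chartMetric g (ι l) (localRep (n := n) ι l x)) x₀ :=
    ((contDiffOn_chartMetric g (ι l)).contDiffAt (by
      rw [localRep, writtenInExtChartAt_center]
      exact extChartAt_target_mem_nhds (ι l))).comp x₀ hrep
  have hLag : IsLagrangianMap (chartMetric g (ι l) (localRep (n := n) ι l x₀))
      (fderiv ℝ (localRep (n := n) ι l) x₀).toLinearMap := by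
    rw [localRep, writtenInExtChartAt_center, chartMetric_center,
      ← tmap_eq_fderiv ((hι.smooth l).mdifferentiableAt (by simp))]
    exact isLagrangianMap_tmap hι hg
  have hdz := contDiffAt_dzForm hrep' v
  have hsqrt := (contDiffAt_gramDet hmetric hrep' v).sqrt (hLag.gramDet_pos hLag.injective v).ne'
  have hvol := Complex.ofRealCLM.contDiff.contDiffAt.comp x₀ (contDiffAt_const (c := s).mul hsqrt)
  refine (hvol.mul (hdz.inv (hLag.dzForm_ne_zero v))).congr_of_eventuallyEq ?_
  filter_upwards [hs, hdz.continuousAt.eventually_ne (hLag.dzForm_ne_zero v)] with x hx hx0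
  exact (eq_mul_inv_iff_mul_eq₀ hx0).2 hx

end VolumeSection

/-! ### The holomorphic volume form in coordinates -/

section HolVolume

variable {n : ℕ} {N : Type*} [TopologicalSpace N] [ChartedSpace (Cn n) N]
  [IsManifold 𝓘(ℂ, Cn n) ω N]

theorem contMDiffOn_det_coordChange (x x' : N) :
    ContMDiffOn 𝓘(ℝ, Cn n) 𝓘(ℝ, ℂ) ∞ (fun y => ((tangentBundleCore 𝓘(ℂ, Cn n) N).coordChange
      (achart (Cn n) x) (achart (Cn n) x') y).det)
      ((chartAt (Cn n) x).source ∩ (chartAt (Cn n) x').source) := by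
  have : IsManifold 𝓘(ℝ, Cn n) (∞ + 1) N := .of_le (n := ω) le_top
  have : (tangentBundleCore 𝓘(ℝ, Cn n) N).IsContMDiff 𝓘(ℝ, Cn n) ∞ :=
    tangentBundleCore.isContMDiff
  have hdz : ContDiff ℝ ∞
      fun T : Cn n →L[ℝ] Cn n => dzForm n fun i => T (EuclideanSpace.single i 1) :=
    contDiff_iff_contDiffAt.2 fun _ => contDiffAt_dzForm contDiffAt_id _
  refine (hdz.contMDiff.comp_contMDiffOn <| (tangentBundleCore 𝓘(ℝ, Cn n) N).contMDiffOn_coordChange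
    (n := ∞) 𝓘(ℝ, Cn n) (achart (Cn n) x) (achart (Cn n) x')).congr fun y hy => ?_
  rw [comp_apply, coordChange_eq_restrictScalars hy.1 hy.2]
  refine Eq.symm <| (dzForm_map ((tangentBundleCore 𝓘(ℂ, Cn n) N).coordChange
    (achart (Cn n) x) (achart (Cn n) x') y).toLinearMap _).trans ?_
  rw [dzForm_single, mul_one]

theorem extChartAt_canonical_target (p : CanonicalBundle n N) :
    (extChartAt (modelK n) p).target = (extChartAt 𝓘(ℝ, Cn n) p.proj).target ×ˢ Set.univ := by
  rw [FiberBundle.extChartAt_target]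
  exact congrArg (· ×ˢ _) (Set.inter_eq_left.2 fun _ => extChartAt_symm_mem_chart_source)

theorem extChartAt_canonical (p q : CanonicalBundle n N) :
    extChartAt (modelK n) p q = (extChartAt 𝓘(ℝ, Cn n) p.proj q.proj,
      (chartDeriv (n := n) p.proj q.proj).det * fiberCoeff q.snd) := by
  rw [FiberBundle.extChartAt]
  rfl

theorem extChartAt_canonical_symm (p : CanonicalBundle n N) (z : Cn n × ℂ) :
    (extChartAt (modelK n) p).symm z = ⟨(extChartAt 𝓘(ℝ, Cn n) p.proj).symm z.1,
      (canonicalCore n N).coordChange (achart (Cn n) p.proj)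
        (achart (Cn n) ((extChartAt 𝓘(ℝ, Cn n) p.proj).symm z.1))
        ((extChartAt 𝓘(ℝ, Cn n) p.proj).symm z.1) z.2⟩ := by
  rw [FiberBundle.extChartAt]
  rfl

theorem extChartAt_canonical_symm_proj (p : CanonicalBundle n N) (z : Cn n × ℂ) :
    ((extChartAt (modelK n) p).symm z).proj = (extChartAt 𝓘(ℝ, Cn n) p.proj).symm z.1 := by
  rw [extChartAt_canonical_symm]

section Target

variable {p : CanonicalBundle n N} {z : Cn n × ℂ}
  (hz : z.1 ∈ (extChartAt 𝓘(ℝ, Cn n) p.proj).target)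

include hz

theorem det_chartDeriv_mul_fiberCoeff_extChartAt_symm :
    (chartDeriv (n := n) p.proj ((extChartAt (modelK n) p).symm z).proj).det *
      fiberCoeff ((extChartAt (modelK n) p).symm z).snd = z.2 := by
  have hright : extChartAt (modelK n) p ((extChartAt (modelK n) p).symm z) = z :=
    (extChartAt (modelK n) p).right_inv (extChartAt_canonical_target p ▸ ⟨hz, trivial⟩)
  rw [extChartAt_canonical] at hright
  exact congrArg Prod.snd hright

theorem trivializationAt_extChartAt_canonical_symm {x : N}
    (hx : (extChartAt 𝓘(ℝ, Cn n) p.proj).symm z.1 ∈ (chartAt (Cn n) x).source) :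
    (trivializationAt ℂ (CanonicalFiber n N) x ((extChartAt (modelK n) p).symm z)).2 =
      ((tangentBundleCore 𝓘(ℂ, Cn n) N).coordChange (achart (Cn n) x) (achart (Cn n) p.proj)
        ((extChartAt 𝓘(ℝ, Cn n) p.proj).symm z.1)).det * z.2 := by
  rw [extChartAt_canonical_symm]
  exact (canonicalCore n N).coordChange_comp (achart (Cn n) p.proj) _ (achart (Cn n) x) _
    ⟨⟨extChartAt_symm_mem_chart_source hz, mem_chart_source _ _⟩, hx⟩ z.2

theorem contMDiffAt_extChartAt_canonical_symm :
    ContMDiffAt 𝓘(ℝ, Cn n × ℂ) (modelK n) ∞ (extChartAt (modelK n) p).symm z := by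
  have hbase : ContMDiffAt 𝓘(ℝ, Cn n × ℂ) 𝓘(ℝ, Cn n) ∞
      (fun z' : Cn n × ℂ => (extChartAt 𝓘(ℝ, Cn n) p.proj).symm z'.1) z :=
    ContMDiffAt.comp (I' := 𝓘(ℝ, Cn n)) z ((contMDiffOn_extChartAt_symm p.proj).contMDiffAt
      ((isOpen_extChartAt_target p.proj).mem_nhds hz)) contDiff_fst.contMDiff.contMDiffAt
  set x := (extChartAt 𝓘(ℝ, Cn n) p.proj).symm z.1
  have hnhds : (chartAt (Cn n) x).source ∩ (chartAt (Cn n) p.proj).source ∈ 𝓝 x :=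
    Filter.inter_mem (chart_source_mem_nhds (Cn n) x)
      ((chartAt (Cn n) p.proj).open_source.mem_nhds (extChartAt_symm_mem_chart_source hz))
  refine Bundle.contMDiffAt_totalSpace.2 ⟨?_, ?_⟩
  · exact hbase.congr_of_eventuallyEq (.of_eq (funext (extChartAt_canonical_symm_proj p)))
  · have hdet := ContMDiffAt.comp z ((contMDiffOn_det_coordChange x p.proj).contMDiffAt hnhds) hbase
    have hmul := (contDiff_mul (𝕜 := ℝ) (𝔸 := ℂ) (n := ∞)).contMDiff.contMDiffAt.comp z
      (hdet.prodMk_space (contDiff_snd.contMDiff.contMDiffAt (x := z)))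
    refine hmul.congr_of_eventuallyEq ?_
    rw [extChartAt_canonical_symm_proj]
    filter_upwards [continuousAt_fst.eventually ((isOpen_extChartAt_target p.proj).mem_nhds hz),
      hbase.continuousAt.eventually hnhds] with z' hz' hx
    exact trivializationAt_extChartAt_canonical_symm hz' hx.1

theorem mfderiv_proj_mfderiv_extChartAt_symm (X : Cn n × ℂ) :
    (mfderiv (modelK n) 𝓘(ℝ, Cn n) (Bundle.TotalSpace.proj : CanonicalBundle n N → N)
        ((extChartAt (modelK n) p).symm z)
        (mfderiv 𝓘(ℝ, Cn n × ℂ) (modelK n) (extChartAt (modelK n) p).symm z X) : Cn n) =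
      chartDeriv (n := n) p.proj ((extChartAt (modelK n) p).symm z).proj X.1 := by
  have : IsManifold 𝓘(ℝ, Cn n) 1 N := .of_le (n := ω) le_top
  have hproj := (Bundle.contMDiffAt_proj (CanonicalFiber n N) (n := ∞) (IB := 𝓘(ℝ, Cn n))
    (p := (extChartAt (modelK n) p).symm z)).mdifferentiableAt (by simp)
  have hleft := hproj.hasMFDerivAt.comp z
    ((contMDiffAt_extChartAt_canonical_symm hz).mdifferentiableAt (by simp)).hasMFDerivAt
  have hright := (mdifferentiableAt_extChartAt_symm hz).hasMFDerivAt.comp z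
    (hasFDerivAt_fst (𝕜 := ℝ)).hasMFDerivAt
  have heq := hasMFDerivAt_unique hleft
    (hright.congr_of_eventuallyEq (.of_eq (funext (extChartAt_canonical_symm_proj p))))
  rw [mfderiv_extChartAt_symm hz, ← extChartAt_canonical_symm_proj] at heq
  exact congrArg (fun T : Cn n × ℂ →L[ℝ] Cn n => T X) heq

theorem tautologicalForm_extChartAt_symm :
    ((tautologicalForm ((extChartAt (modelK n) p).symm z)).compContinuousLinearMap
      (mfderiv 𝓘(ℝ, Cn n × ℂ) (modelK n) (extChartAt (modelK n) p).symm z) :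
        (Cn n × ℂ) [⋀^Fin n]→L[ℝ] ℂ) =
      z.2 • (dzForm n).compContinuousLinearMap (ContinuousLinearMap.fst ℝ (Cn n) ℂ) := by
  ext X
  calc
    _ = fiberCoeff ((extChartAt (modelK n) p).symm z).snd * dzForm n fun i =>
        chartDeriv (n := n) p.proj ((extChartAt (modelK n) p).symm z).proj (X i).1 :=
      congrArg (fun w => _ * dzForm n w)
        (funext fun i => mfderiv_proj_mfderiv_extChartAt_symm hz (X i))
    _ = fiberCoeff ((extChartAt (modelK n) p).symm z).snd *
        ((chartDeriv (n := n) p.proj ((extChartAt (modelK n) p).symm z).proj).det *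
          dzForm n fun i => (X i).1) := congrArg _ (dzForm_map _ _)
    _ = z.2 * dzForm n fun i => (X i).1 := by
      rw [← det_chartDeriv_mul_fiberCoeff_extChartAt_symm hz]
      ring

end Target

/-- In coordinates `(z, y)` the form `φ` is `dy ∧ dz₁ ∧ … ∧ dzₙ`. -/
theorem holVolumeForm_eq (p : CanonicalBundle n N) :
    holVolumeForm p = ContinuousAlternatingMap.alternatizeUncurryFin
      ((ContinuousLinearMap.snd ℝ (Cn n) ℂ).smulRight
        ((dzForm n).compContinuousLinearMap (ContinuousLinearMap.fst ℝ (Cn n) ℂ))) := by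
  set η : (Cn n × ℂ) [⋀^Fin n]→L[ℝ] ℂ :=
    (dzForm n).compContinuousLinearMap (ContinuousLinearMap.fst ℝ (Cn n) ℂ)
  have hchart : holVolumeForm p =
      extDeriv (fun z : Cn n × ℂ => z.2 • η) (extChartAt (modelK n) p p) := by
    refine Filter.EventuallyEq.extDeriv_eq ?_
    filter_upwards [extChartAt_target_mem_nhds (I := modelK n) p] with z hz
    rw [extChartAt_canonical_target] at hz
    exact tautologicalForm_extChartAt_symm hz.1
  rw [hchart, extDeriv, (hasFDerivAt_snd.smul_const η).fderiv]

theorem holVolumeForm_apply (p : CanonicalBundle n N) (X : Fin (n + 1) → Cn n × ℂ) :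
    holVolumeForm p X = ∑ i : Fin (n + 1), (-1) ^ (i : ℕ) •
      ((X i).2 * dzForm n fun j => (i.removeNth X j).1) := by
  rw [holVolumeForm_eq]
  exact ContinuousAlternatingMap.alternatizeUncurryFin_apply _ X

end HolVolume

/-! ### The Hermitian form of a Hermitian inner product -/

section HermForm

variable {W : Type*} [NormedAddCommGroup W] [NormedSpace ℝ W] [NormedSpace ℂ W]

/-- The Hermitian form `h(v, w) = g(v, w) + i g(v, iw)`, complex linear in `v`, of a Hermitian
inner product `g`; its Gram matrices define the norm on the canonical bundle. -/
def hermForm (B : W →L[ℝ] W →L[ℝ] ℝ) (v w : W) : ℂ :=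
  (B v w : ℂ) + Complex.I * B v (Complex.I • w)

variable {B : W →L[ℝ] W →L[ℝ] ℝ} {ι : Type*}

theorem hermForm_conj (hB : IsHermitianInner B) (v w : W) :
    conj (hermForm B v w) = hermForm B w v := by
  have hI : B w (Complex.I • v) = -B v (Complex.I • w) := by
    rw [hB.symm v, hB.I_smul_left, neg_neg]
  simp [hermForm, hI, hB.symm v w]

theorem hermForm_self (hB : IsHermitianInner B) (v : W) : hermForm B v v = (B v v : ℂ) := by
  have hI : B v (Complex.I • v) = 0 := by
    linarith [hB.I_smul_left v v, hB.symm v (Complex.I • v)]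
  simp [hermForm, hI]

theorem hermForm_sum_left (s : Finset ι) (v : ι → W) (w : W) :
    hermForm B (∑ i ∈ s, v i) w = ∑ i ∈ s, hermForm B (v i) w := by
  simp [hermForm, Finset.sum_add_distrib, Finset.mul_sum]

variable [IsScalarTower ℝ ℂ W]

theorem hermForm_smul_left (hB : IsHermitianInner B) (c : ℂ) (v w : W) :
    hermForm B (c • v) w = c * hermForm B v w := by
  rw [hermForm, hermForm, apply_complex_smul_left B c v w,
    apply_complex_smul_left B c v (Complex.I • w), hB.herm v w, hB.I_smul_left v w]
  apply Complex.ext <;> simp [sub_eq_add_neg]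

theorem hermForm_sum_smul_sum_smul (hB : IsHermitianInner B) (s : Finset ι) (c : ι → ℂ)
    (v : ι → W) : hermForm B (∑ i ∈ s, c i • v i) (∑ i ∈ s, c i • v i) =
      ∑ i ∈ s, ∑ j ∈ s, c i * hermForm B (v i) (v j) * conj (c j) := by
  rw [hermForm_sum_left]
  refine Finset.sum_congr rfl fun i _ => ?_
  rw [hermForm_smul_left hB, ← hermForm_conj hB, hermForm_sum_left, map_sum, Finset.mul_sum]
  refine Finset.sum_congr rfl fun j _ => ?_
  rw [hermForm_smul_left hB, map_mul, hermForm_conj hB]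
  ring

open scoped ComplexOrder in
theorem posDef_hermForm [Finite ι] (hB : IsHermitianInner B) {v : ι → W}
    (hv : LinearIndependent ℂ v) : (Matrix.of fun i j => hermForm B (v i) (v j)).PosDef := by
  have := Fintype.ofFinite ι
  refine Matrix.PosDef.of_dotProduct_mulVec_pos
    (Matrix.IsHermitian.ext fun i j => hermForm_conj hB _ _) fun c hc => ?_
  set X := ∑ i, conj (c i) • v i
  have hX : X ≠ 0 := fun h0 => hc <| funext fun i =>
    (map_eq_zero _).1 (Fintype.linearIndependent_iff.1 hv (fun i => conj (c i)) h0 i)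
  have hquad : star c ⬝ᵥ (Matrix.of fun i j => hermForm B (v i) (v j)).mulVec c = (B X X : ℂ) := by
    rw [← hermForm_self hB, hermForm_sum_smul_sum_smul hB]
    simp only [dotProduct, Matrix.mulVec, Finset.mul_sum, Matrix.of_apply, Pi.star_apply,
      starRingEnd_apply, star_star, mul_assoc]
  rw [hquad]
  exact_mod_cast hB.pos X hX

end HermForm

open scoped ComplexOrder in
theorem dzNormSq_pos {n : ℕ} {N : Type*} [TopologicalSpace N] [ChartedSpace (Cn n) N]
    [IsManifold 𝓘(ℂ, Cn n) ω N] {g : RMetric n N} {x : N} (hg : IsHermitianInner (inn g x)) :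
    0 < dzNormSq g x := by
  have hpos : (hermGram g x).PosDef := posDef_hermForm hg
    (v := fun i => EuclideanSpace.single i (1 : ℂ)) <| by
      simpa only [coe_basisFun_toBasis] using
        (EuclideanSpace.basisFun (Fin n) ℂ).toBasis.linearIndependent
  exact inv_pos.2 (Complex.lt_def.1 hpos.det_pos).1

/-! ### The cone over a section along an immersion -/

section Cone

variable {n : ℕ} {N : Type*} [TopologicalSpace N] [ChartedSpace (Cn n) N]
  [IsManifold 𝓘(ℂ, Cn n) ω N]
  {L : Type*} {ι : L → N} {κ : ∀ l, CanonicalFiber n N (ι l)}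

theorem fiberCoeff_coneMap (q : L × ℝ) :
    fiberCoeff (coneMap ι κ q).snd = q.2 * fiberCoeff (κ q.1) := rfl

theorem trivializationAt_coneMap (l : L) (q : L × ℝ) :
    trivializationAt ℂ (CanonicalFiber n N) (ι l) (coneMap ι κ q) =
      (ι q.1, q.2 * fiberCoord ι κ l q.1) := by
  rw [trivializationAt_canonical, fiberCoeff_coneMap, fiberCoord_eq, mul_left_comm]
  rfl

theorem coneMap_injective (hι : Injective ι) (hκ : ∀ l, fiberCoeff (κ l) ≠ 0) :
    Injective (coneMap ι κ) := by
  rintro ⟨l, a⟩ ⟨l', a'⟩ h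
  obtain rfl : l = l' := hι (congrArg Bundle.TotalSpace.proj h)
  have hcoord := congrArg (fun p => (trivializationAt ℂ (CanonicalFiber n N) (ι l) p).2) h
  simp only [trivializationAt_coneMap, fiberCoord_self] at hcoord
  rw [Complex.ofReal_inj.1 (mul_right_cancel₀ (hκ l) hcoord)]

section Topology

variable [TopologicalSpace L] {ℱ : Filter (L × ℝ)} {q : L × ℝ}

theorem tendsto_fst_of_tendsto_coneMap (hι : Topology.IsInducing ι)
    (h : Filter.Tendsto (coneMap ι κ) ℱ (𝓝 (coneMap ι κ q))) :
    Filter.Tendsto Prod.fst ℱ (𝓝 q.1) := by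
  rw [hι.nhds_eq_comap, Filter.tendsto_comap_iff]
  exact ((FiberBundle.continuous_proj ℂ (CanonicalFiber n N)).tendsto _).comp h

theorem tendsto_snd_of_tendsto_coneMap (hκ : fiberCoeff (κ q.1) ≠ 0)
    (hcont : ContinuousAt (fiberCoord ι κ q.1) q.1)
    (h : Filter.Tendsto (coneMap ι κ) ℱ (𝓝 (coneMap ι κ q)))
    (hfst : Filter.Tendsto Prod.fst ℱ (𝓝 q.1)) : Filter.Tendsto Prod.snd ℱ (𝓝 q.2) := by
  have hcoord := hcont.tendsto.comp hfst
  have hne : fiberCoord ι κ q.1 q.1 ≠ 0 := fiberCoord_self (κ := κ) q.1 ▸ hκ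
  have htriv := ((trivializationAt ℂ (CanonicalFiber n N) (ι q.1)).continuousAt
    ((Bundle.Trivialization.mem_source _).2 (FiberBundle.mem_baseSet_trivializationAt'
      (F := ℂ) (E := CanonicalFiber n N) (ι q.1)) : coneMap ι κ q ∈ _)).tendsto.comp h
  have hprod : Filter.Tendsto (fun q' : L × ℝ => (q'.2 : ℂ) * fiberCoord ι κ q.1 q'.1) ℱ
      (𝓝 ((q.2 : ℂ) * fiberCoord ι κ q.1 q.1)) := by
    simpa only [comp_def, Bundle.Trivialization.coe_coe, trivializationAt_coneMap] using
      (continuous_snd.tendsto _).comp htriv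
  have hdiv := hprod.div hcoord hne
  rw [mul_div_cancel_right₀ _ hne] at hdiv
  have hsnd : Filter.Tendsto (fun q' : L × ℝ => (q'.2 : ℂ)) ℱ (𝓝 (q.2 : ℂ)) := by
    refine hdiv.congr' ?_
    filter_upwards [hcoord.eventually_ne hne] with q' hq'
    exact mul_div_cancel_right₀ _ hq'
  exact (Complex.continuous_re.tendsto _).comp hsnd

theorem isEmbedding_coneMap (hι : Topology.IsEmbedding ι) (hκ : ∀ l, fiberCoeff (κ l) ≠ 0)
    (hcont : ∀ l, ContinuousAt (fiberCoord ι κ l) l) (hF : Continuous (coneMap ι κ)) :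
    Topology.IsEmbedding (coneMap ι κ) := by
  refine ⟨Topology.isInducing_iff_nhds.2 fun q =>
    le_antisymm (hF.tendsto q).le_comap ?_, coneMap_injective hι.injective hκ⟩
  have hfst := tendsto_fst_of_tendsto_coneMap (n := n) (κ := κ) (q := q) hι.isInducing
    Filter.tendsto_comap
  exact Filter.tendsto_id'.1 <| hfst.prodMk_nhds <|
    tendsto_snd_of_tendsto_coneMap (hκ q.1) (hcont q.1) Filter.tendsto_comap hfst

end Topology

variable [TopologicalSpace L] [ChartedSpace (EuclideanSpace ℝ (Fin n)) L]

theorem writtenInExtChartAt_coneMap (q : L × ℝ) :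
    writtenInExtChartAt ((𝓡 n).prod 𝓘(ℝ, ℝ)) (modelK n) q (coneMap ι κ) =
      fun y => (localRep (n := n) ι q.1 y.1,
        (y.2 : ℂ) * fiberCoord ι κ q.1 ((extChartAt (𝓡 n) q.1).symm y.1)) := by
  funext y
  rw [writtenInExtChartAt, comp_apply, comp_apply, FiberBundle.extChartAt, extChartAt_prod]
  change ((extChartAt 𝓘(ℝ, Cn n) (ι q.1)).prod (PartialEquiv.refl ℂ))
    (trivializationAt ℂ (CanonicalFiber n N) (ι q.1) (coneMap ι κ _)) = _
  rw [trivializationAt_coneMap]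
  rfl

theorem contMDiffAt_fiberCoord {l : L}
    (hκ : ContDiffAt ℝ ∞ (localFiberCoord (n := n) ι κ l) (extChartAt (𝓡 n) l l)) :
    ContMDiffAt (𝓡 n) 𝓘(ℝ, ℂ) ∞ (fiberCoord ι κ l) l := by
  refine (hκ.contMDiffAt.comp l
    (contMDiffAt_extChartAt (I := 𝓡 n) (n := ∞) (x := l))).congr_of_eventuallyEq ?_
  filter_upwards [extChartAt_source_mem_nhds (I := 𝓡 n) l] with l' hl'
  rw [comp_apply, localFiberCoord, (extChartAt (𝓡 n) l).left_inv hl']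

theorem contMDiffAt_coneMap {q : L × ℝ} (hι : ContMDiffAt (𝓡 n) 𝓘(ℝ, Cn n) ∞ ι q.1)
    (hκ : ContDiffAt ℝ ∞ (localFiberCoord (n := n) ι κ q.1) (extChartAt (𝓡 n) q.1 q.1)) :
    ContMDiffAt ((𝓡 n).prod 𝓘(ℝ, ℝ)) (modelK n) ∞ (coneMap ι κ) q := by
  rw [Bundle.contMDiffAt_totalSpace]
  refine ⟨hι.comp q contMDiffAt_fst, ?_⟩
  have hcoord : ContMDiffAt ((𝓡 n).prod 𝓘(ℝ, ℝ)) 𝓘(ℝ, ℂ) ∞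
      (fun q' : L × ℝ => fiberCoord ι κ q.1 q'.1) q :=
    (contMDiffAt_fiberCoord hκ).comp q contMDiffAt_fst
  have hscale : ContMDiffAt ((𝓡 n).prod 𝓘(ℝ, ℝ)) 𝓘(ℝ, ℂ) ∞ (fun q' : L × ℝ => (q'.2 : ℂ)) q :=
    Complex.ofRealCLM.contDiff.contMDiff.contMDiffAt.comp q contMDiffAt_snd
  refine ((contDiff_mul (𝕜 := ℝ) (𝔸 := ℂ) (n := ∞)).contMDiff.contMDiffAt.comp q
    (hscale.prodMk_space hcoord)).congr_of_eventuallyEq (Filter.Eventually.of_forall fun q' => ?_)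
  exact congrArg Prod.snd (trivializationAt_coneMap q.1 q')

theorem mfderiv_coneMap {q : L × ℝ} (hι : ContMDiffAt (𝓡 n) 𝓘(ℝ, Cn n) ∞ ι q.1)
    (hκ : ContDiffAt ℝ ∞ (localFiberCoord (n := n) ι κ q.1) (extChartAt (𝓡 n) q.1 q.1))
    (X : EuclideanSpace ℝ (Fin n) × ℝ) :
    (mfderiv ((𝓡 n).prod 𝓘(ℝ, ℝ)) (modelK n) (coneMap ι κ) q X : Cn n × ℂ) =
      (tmap (n := n) ι q.1 X.1, X.2 * fiberCoeff (κ q.1) +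
        q.2 * fderiv ℝ (localFiberCoord (n := n) ι κ q.1) (extChartAt (𝓡 n) q.1 q.1) X.1) := by
  set x₀ : EuclideanSpace ℝ (Fin n) × ℝ := (extChartAt (𝓡 n) q.1 q.1, q.2)
  have hx₀ : extChartAt ((𝓡 n).prod 𝓘(ℝ, ℝ)) q q = x₀ := by
    rw [extChartAt_prod]
    rfl
  have hfst : HasFDerivAt Prod.fst _ x₀ := hasFDerivAt_fst (𝕜 := ℝ)
  have hsnd : HasFDerivAt Prod.snd _ x₀ := hasFDerivAt_snd (𝕜 := ℝ)
  have hbase := ((contDiffAt_writtenInExtChartAt hι).differentiableAt (by simp)).hasFDerivAt.comp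
    x₀ hfst
  have hcoord := (hκ.differentiableAt (by simp)).hasFDerivAt.comp x₀ hfst
  have hscale := Complex.ofRealCLM.hasFDerivAt.comp x₀ hsnd
  have hderiv := (hbase.prodMk (hscale.mul hcoord)).fderiv
  rw [((contMDiffAt_coneMap hι hκ).mdifferentiableAt (by simp)).mfderiv,
    writtenInExtChartAt_coneMap, hx₀, ((𝓡 n).prod 𝓘(ℝ, ℝ)).range_eq_univ, fderivWithin_univ]
  refine (congrArg (fun T : EuclideanSpace ℝ (Fin n) × ℝ →L[ℝ] Cn n × ℂ => T X) hderiv).trans ?_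
  have hself : localFiberCoord (n := n) ι κ q.1 x₀.1 = fiberCoeff (κ q.1) := by
    rw [← fiberCoord_self (κ := κ), localFiberCoord, extChartAt_to_inv]
  rw [tmap_eq_fderiv (hι.mdifferentiableAt (by simp)), ← hself]
  exact Prod.ext rfl ((add_comm _ _).trans (congrArg (· + _) (mul_comm _ _)))

end Cone

theorem sum_neg_one_pow_smul_mul_removeNth_eq_zero {V : Type*} [NormedAddCommGroup V]
    [NormedSpace ℝ V] [FiniteDimensional ℝ V] {k : ℕ} (hV : finrank ℝ V ≤ k) (α : V →L[ℝ] ℂ)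
    (η : V [⋀^Fin k]→L[ℝ] ℂ) (v : Fin (k + 1) → V) :
    ∑ i : Fin (k + 1), (-1) ^ (i : ℕ) • (α (v i) * η (i.removeNth v)) = 0 := by
  refine (ContinuousAlternatingMap.alternatizeUncurryFin_apply (α.smulRight η) v).symm.trans ?_
  refine AlternatingMap.map_linearDependent (K := ℝ)
    (ContinuousAlternatingMap.alternatizeUncurryFin (α.smulRight η)).toAlternatingMap v fun hv => ?_
  have hcard := hv.fintype_card_le_finrank
  rw [Fintype.card_fin] at hcard
  omega

/-! ### The Calabi metric -/

section Calabi

variable {n : ℕ} {N : Type*} [TopologicalSpace N] [ChartedSpace (Cn n) N]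
  [IsManifold 𝓘(ℂ, Cn n) ω N] {g : RMetric n N}

theorem connForm_zero (x : N) : connForm g x 0 = 0 := by
  simp only [connForm, map_zero, zero_apply, ContinuousAlternatingMap.map_update_zero,
    Finset.sum_const_zero, neg_zero]

theorem connForm_eq_neg_trace (hg : IsKahler g) (x : N) (v : Cn n) :
    connForm g x v = -LinearMap.trace ℂ _ ((hg.isKahlerAt x).christoffelEnd v) :=
  congrArg Neg.neg (sum_dzForm_update_single ((hg.isKahlerAt x).christoffelEnd v))

theorem connForm_I_smul (hg : IsKahler g) (x : N) (v : Cn n) :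
    connForm g x (Complex.I • v) = Complex.I * connForm g x v := by
  have h := hg.isKahlerAt x
  have hEnd : h.christoffelEnd (Complex.I • v) = Complex.I • h.christoffelEnd v := by
    ext1 w
    simp only [IsKahlerAt.christoffelEnd_apply, LinearMap.smul_apply,
      christoffel_symm h.differentiableAt h.inner _ w, h.christoffel_I_smul]
  rw [connForm_eq_neg_trace hg, connForm_eq_neg_trace hg, hEnd, map_smul, smul_eq_mul, mul_neg]

theorem vertPart_I_smul (hg : IsKahler g) (p : CanonicalBundle n N) (X : Cn n × ℂ) :
    vertPart g p (Complex.I • X) = Complex.I * vertPart g p X := by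
  change Complex.I * X.2 + fiberCoeff p.snd * connForm g p.proj (Complex.I • X.1) =
    Complex.I * (X.2 + fiberCoeff p.snd * connForm g p.proj X.1)
  rw [connForm_I_smul hg]
  ring

theorem calabiForm_eq (hg : IsKahler g) (t : ℝ) (u : ℝ → ℝ) (p : CanonicalBundle n N)
    (X Y : TangentSpace (modelK n) p) : calabiForm g t u p X Y =
      u (rSq g p) * kahlerForm g p.proj X.1 Y.1 - 2 * t⁻¹ * deriv u (rSq g p) *
        dzNormSq g p.proj * (vertPart g p X * conj (vertPart g p Y)).im := by
  change u (rSq g p) * kahlerForm g p.proj X.1 Y.1 + t⁻¹ * deriv u (rSq g p) * (2 * (fiberInner g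
    p.proj (vertPart g p (Complex.I • (show Cn n × ℂ from X))) (vertPart g p Y)).re) = _
  rw [vertPart_I_smul hg, fiberInner, mul_assoc Complex.I, Complex.re_ofReal_mul, Complex.I_mul_re]
  ring

theorem rSq_eq (p : CanonicalBundle n N) :
    rSq g p = dzNormSq g p.proj * Complex.normSq (fiberCoeff p.snd) := by
  change (((dzNormSq g p.proj : ℝ) : ℂ) * (fiberCoeff p.snd * conj (fiberCoeff p.snd))).re = _
  rw [Complex.mul_conj, ← Complex.ofReal_mul, Complex.ofReal_re]

theorem rSq_nonneg {p : CanonicalBundle n N} (hg : IsHermitianInner (inn g p.proj)) :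
    0 ≤ rSq g p := by
  rw [rSq_eq]
  exact mul_nonneg (dzNormSq_pos hg).le (Complex.normSq_nonneg _)

end Calabi

theorem deriv_calabiProfile_pos (n : ℕ) {t c s : ℝ} (ht : 0 < t) (hc : 0 < c) (hs : 0 ≤ s) :
    0 < deriv (calabiProfile n t c) s := by
  have hpos : 0 < t * s + c := by positivity
  have hlin : HasDerivAt (fun s => t * s + c) t s := by
    simpa using ((hasDerivAt_id s).const_mul t).add_const c
  have hpow : HasDerivAt (calabiProfile n t c) _ s :=
    hlin.rpow_const (p := (1 : ℝ) / (n + 1)) (Or.inl hpos.ne')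
  rw [hpow.deriv]
  positivity

/-! ### The connection form of the volume section -/

section Connection

variable {n : ℕ} {N : Type*} [TopologicalSpace N] [ChartedSpace (Cn n) N]
  [IsManifold 𝓘(ℂ, Cn n) ω N] {g : RMetric n N}
  {L : Type*} [TopologicalSpace L] [ChartedSpace (EuclideanSpace ℝ (Fin n)) L]
  {ι : L → N} {κ : ∀ l, CanonicalFiber n N (ι l)}

/-- The coefficient `∇_u κ / κ` of the covariant derivative of a section `κ` of `K(N)` along `ι`:
the connection form of `ι^*K(N)` in the frame `κ`. -/
def connCoeff (g : RMetric n N) (ι : L → N) (κ : ∀ l, CanonicalFiber n N (ι l)) (l : L)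
    (u : EuclideanSpace ℝ (Fin n)) : ℂ :=
  fderiv ℝ (localFiberCoord (n := n) ι κ l) (extChartAt (𝓡 n) l l) u / fiberCoeff (κ l) +
    connForm g (ι l) (tmap (n := n) ι l u)

theorem connCoeff_zero (l : L) : connCoeff g ι κ l 0 = 0 := by
  rw [connCoeff, map_zero, zero_div, zero_add]
  exact (congrArg (connForm g (ι l)) (map_zero (tmap (n := n) ι l))).trans (connForm_zero _)

theorem covDerivAlong_eq_covDeriv {l : L} (hι : MDifferentiableAt (𝓡 n) 𝓘(ℝ, Cn n) ι l)
    (v w : EuclideanSpace ℝ (Fin n)) : covDerivAlong g ι l v w =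
      covDeriv (chartMetric g (ι l)) (localRep (n := n) ι l) (extChartAt (𝓡 n) l l) v w := by
  rw [covDeriv, ← tmap_eq_fderiv hι, localRep, writtenInExtChartAt_center]
  rfl

variable [IsManifold (𝓡 n) ∞ L] (hg : IsKahler g) (hι : IsLagrangian g ι)
  {o : ∀ l : L, Orientation ℝ (TangentSpace (𝓡 n) l) (Fin n)} (ho : IsOrientation o)
  (hκ : IsVolumeSection g ι o κ)

include hg hι ho hκ

theorem im_connCoeff {l : L} {v : Basis (Fin n) ℝ (TangentSpace (𝓡 n) l)}
    (hv : IsOrthonormalFrame g ι l v) (u : EuclideanSpace ℝ (Fin n)) :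
    (connCoeff g ι κ l u).im = -inn g (ι l) (∑ j, covDerivAlong g ι l (v j) (v j))
      (Complex.I • tmap (n := n) ι l u) := by
  set x₀ := extChartAt (𝓡 n) l l
  have hmd := (hι.smooth l).mdifferentiableAt (by simp)
  have hζ : localRep (n := n) ι l x₀ = extChartAt 𝓘(ℝ, Cn n) (ι l) (ι l) :=
    writtenInExtChartAt_center ι l
  have hmetric : chartMetric g (ι l) (localRep (n := n) ι l x₀) = inn g (ι l) := by
    rw [hζ, chartMetric_center]
  have hcoord : localFiberCoord (n := n) ι κ l x₀ = fiberCoeff (κ l) := by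
    rw [localFiberCoord, extChartAt_to_inv, fiberCoord_self]
  let v' : Basis (Fin n) ℝ (EuclideanSpace ℝ (Fin n)) := v
  have hv' : IsOrthonormalFor (chartMetric g (ι l) (localRep (n := n) ι l x₀))
      (fderiv ℝ (localRep (n := n) ι l) x₀).toLinearMap v' := by
    rw [hmetric, ← tmap_eq_fderiv hmd]
    exact hv
  have hreal : ∀ᶠ x in 𝓝 x₀, (localFiberCoord (n := n) ι κ l x *
      dzForm n fun i => fderiv ℝ (localRep (n := n) ι l) x (v' i)).im = 0 := by
    obtain ⟨s, hs⟩ := hκ.localFiberCoord_mul_dzForm hι ho l v'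
    filter_upwards [hs] with x hx
    rw [hx, Complex.ofReal_im]
  have hmain := (isLocalLagrangian_localRep hg hι l).im_logDeriv_sub_trace hv'
    ((hκ.contDiffAt_localFiberCoord hι ho (hg.isHermitianInner _)).differentiableAt (by simp))
    (hcoord ▸ hκ.ne_zero hι l) hreal u
  simp only [← covDerivAlong_eq_covDeriv hmd] at hmain
  have htrace : LinearMap.trace ℂ _ ((isLocalLagrangian_localRep hg hι l).kahler.christoffelEnd
      (fderiv ℝ (localRep (n := n) ι l) x₀ u)) = -connForm g (ι l) (tmap (n := n) ι l u) := by
    rw [connForm_eq_neg_trace hg, neg_neg, ← tmap_eq_fderiv hmd]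
    refine congrArg (LinearMap.trace ℂ _) (LinearMap.ext fun w => ?_)
    simp only [IsKahlerAt.christoffelEnd_apply, x₀, hζ]
    rfl
  rw [htrace, hmetric, hcoord, sub_neg_eq_add, ← tmap_eq_fderiv hmd] at hmain
  exact hmain

theorem isMinimal_iff : IsMinimal g ι ↔ ∀ l u, (connCoeff g ι κ l u).im = 0 := by
  refine ⟨fun hmin l u => ?_, fun h l v hv ν hν => ?_⟩
  · obtain ⟨v, hv⟩ := exists_isOrthonormalFrame hι l
    rw [im_connCoeff hg hι ho hκ hv, hmin l v hv _ fun w => hι.lagrangian l u w, neg_zero]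
  · obtain ⟨u, rfl⟩ := (isLagrangianMap_tmap hι (hg.isHermitianInner _)).exists_eq_I_smul_of_normal
      (v := v) hv hν
    exact neg_eq_zero.1 ((im_connCoeff hg hι ho hκ hv u).symm.trans (h l u))

end Connection

/-! ### The two forms on the cone -/

section ConeForms

variable {n : ℕ} {N : Type*} [TopologicalSpace N] [ChartedSpace (Cn n) N]
  [IsManifold 𝓘(ℂ, Cn n) ω N] {g : RMetric n N}
  {L : Type*} [TopologicalSpace L] [ChartedSpace (EuclideanSpace ℝ (Fin n)) L]
  {ι : L → N} {κ : ∀ l, CanonicalFiber n N (ι l)} {q : L × ℝ}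

section Section

variable (hι : ContMDiffAt (𝓡 n) 𝓘(ℝ, Cn n) ∞ ι q.1)
  (hκ : ContDiffAt ℝ ∞ (localFiberCoord (n := n) ι κ q.1) (extChartAt (𝓡 n) q.1 q.1))

include hι hκ

theorem mfderiv_coneMap_injective (hτ : Injective (tmap (n := n) ι q.1))
    (hne : fiberCoeff (κ q.1) ≠ 0) :
    Injective (mfderiv ((𝓡 n).prod 𝓘(ℝ, ℝ)) (modelK n) (coneMap ι κ) q) := by
  refine (injective_iff_map_eq_zero _).2 fun X hX => ?_
  have hzero := (mfderiv_coneMap hι hκ X).symm.trans hX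
  have hbase : X.1 = 0 := hτ ((congrArg Prod.fst hzero).trans (map_zero _).symm)
  have hfiber : (X.2 : ℂ) * fiberCoeff (κ q.1) = 0 := by
    have hsnd : (X.2 : ℂ) * fiberCoeff (κ q.1) + q.2 * fderiv ℝ (localFiberCoord (n := n) ι κ q.1)
        (extChartAt (𝓡 n) q.1 q.1) X.1 = 0 := congrArg Prod.snd hzero
    rwa [hbase, map_zero, mul_zero, add_zero] at hsnd
  exact Prod.ext hbase (Complex.ofReal_eq_zero.1 ((mul_eq_zero.1 hfiber).resolve_right hne))

theorem vertPart_mfderiv_coneMap (hne : fiberCoeff (κ q.1) ≠ 0)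
    (X : EuclideanSpace ℝ (Fin n) × ℝ) :
    vertPart g (coneMap ι κ q) (mfderiv ((𝓡 n).prod 𝓘(ℝ, ℝ)) (modelK n) (coneMap ι κ) q X) =
      fiberCoeff (κ q.1) * (X.2 + q.2 * connCoeff g ι κ q.1 X.1) := by
  refine (congrArg (vertPart g (coneMap ι κ q)) (mfderiv_coneMap hι hκ X)).trans ?_
  change _ + (q.2 * fiberCoeff (κ q.1)) * connForm g (ι q.1) (tmap (n := n) ι q.1 X.1) = _
  rw [connCoeff]
  field_simp
  ring

/-- The derivative of `κ` enters only through an `(n + 1)`-form on `T_lL`. -/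
theorem holVolumeForm_mfderiv_coneMap (X : Fin (n + 1) → EuclideanSpace ℝ (Fin n) × ℝ) :
    (holVolumeForm (coneMap ι κ q) fun i =>
      mfderiv ((𝓡 n).prod 𝓘(ℝ, ℝ)) (modelK n) (coneMap ι κ) q (X i)) =
    ∑ i : Fin (n + 1), (-1) ^ (i : ℕ) • ((X i).2 *
      (fiberCoeff (κ q.1) * dzForm n fun j => tmap (n := n) ι q.1 (i.removeNth X j).1)) := by
  let κ' := fderiv ℝ (localFiberCoord (n := n) ι κ q.1) (extChartAt (𝓡 n) q.1 q.1)
  let τ : EuclideanSpace ℝ (Fin n) →L[ℝ] Cn n := tmap (n := n) ι q.1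
  have hzero : ∑ i : Fin (n + 1), (-1) ^ (i : ℕ) •
      (κ' (X i).1 * dzForm n fun j => τ (i.removeNth X j).1) = 0 :=
    sum_neg_one_pow_smul_mul_removeNth_eq_zero finrank_euclideanSpace_fin.le κ'
      ((dzForm n).compContinuousLinearMap τ) fun i => (X i).1
  calc
    _ = holVolumeForm (coneMap ι κ q) fun i =>
        ((τ (X i).1, (X i).2 * fiberCoeff (κ q.1) + q.2 * κ' (X i).1) : Cn n × ℂ) :=
      congrArg (holVolumeForm (coneMap ι κ q)) (funext fun i => mfderiv_coneMap hι hκ (X i))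
    _ = ∑ i : Fin (n + 1), (-1) ^ (i : ℕ) •
        (((X i).2 * fiberCoeff (κ q.1) + q.2 * κ' (X i).1) *
          dzForm n fun j => τ (i.removeNth X j).1) := holVolumeForm_apply _ _
    _ = ∑ i : Fin (n + 1), (-1) ^ (i : ℕ) • ((X i).2 *
          (fiberCoeff (κ q.1) * dzForm n fun j => τ (i.removeNth X j).1)) +
        q.2 * ∑ i : Fin (n + 1), (-1) ^ (i : ℕ) •
          (κ' (X i).1 * dzForm n fun j => τ (i.removeNth X j).1) := by
      simp only [Finset.mul_sum, ← Finset.sum_add_distrib, zsmul_eq_mul]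
      exact Finset.sum_congr rfl fun i _ => by ring
    _ = _ := by rw [hzero, mul_zero, add_zero]; rfl

end Section

section VolumeSection

variable {o : ∀ l : L, Orientation ℝ (TangentSpace (𝓡 n) l) (Fin n)}
  (hκ : IsVolumeSection g ι o κ)

include hκ

theorem IsVolumeSection.im_mul_dzForm (l : L) (w : Fin n → TangentSpace (𝓡 n) l) :
    (fiberCoeff (κ l) * dzForm n fun j => tmap ι l (w j)).im = 0 := by
  let v : Basis (Fin n) ℝ (TangentSpace (𝓡 n) l) := (EuclideanSpace.basisFun (Fin n) ℝ).toBasis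
  have hdet : (dzForm n fun j => tmap ι l (w j)) =
      (v.det w : ℂ) * dzForm n fun j => tmap ι l (v j) :=
    dzForm_comp_eq_det_mul (tmap (n := n) ι l).toLinearMap v w
  rw [hdet, mul_left_comm, hκ l v, ← Complex.ofReal_mul, Complex.ofReal_im]

variable [IsManifold (𝓡 n) ∞ L] (hι : IsLagrangian g ι) (ho : IsOrientation o)

include hι ho

theorem IsVolumeSection.im_holVolumeForm_coneMap (hg : IsHermitianInner (inn g (ι q.1)))
    (X : Fin (n + 1) → EuclideanSpace ℝ (Fin n) × ℝ) :
    (holVolumeForm (coneMap ι κ q) fun i =>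
      mfderiv ((𝓡 n).prod 𝓘(ℝ, ℝ)) (modelK n) (coneMap ι κ) q (X i)).im = 0 := by
  rw [holVolumeForm_mfderiv_coneMap (hι.smooth q.1) (hκ.contDiffAt_localFiberCoord hι ho hg),
    Complex.im_sum]
  refine Finset.sum_eq_zero fun i _ => ?_
  have him := hκ.im_mul_dzForm q.1 fun j => (i.removeNth X j).1
  rw [← Complex.imCLM_apply, map_zsmul, Complex.imCLM_apply, Complex.im_ofReal_mul]
  exact smul_eq_zero_of_right _ (mul_eq_zero_of_right _ him)

variable (hg : IsKahler g)

include hg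

theorem IsVolumeSection.calabiForm_coneMap (t : ℝ) (u : ℝ → ℝ)
    (X Y : EuclideanSpace ℝ (Fin n) × ℝ) :
    calabiForm g t u (coneMap ι κ q)
        (mfderiv ((𝓡 n).prod 𝓘(ℝ, ℝ)) (modelK n) (coneMap ι κ) q X)
        (mfderiv ((𝓡 n).prod 𝓘(ℝ, ℝ)) (modelK n) (coneMap ι κ) q Y) =
      -(2 * t⁻¹ * deriv u (rSq g (coneMap ι κ q)) * dzNormSq g (ι q.1) *
        Complex.normSq (fiberCoeff (κ q.1))) *
        ((X.2 + q.2 * connCoeff g ι κ q.1 X.1) *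
          conj (Y.2 + q.2 * connCoeff g ι κ q.1 Y.1)).im := by
  have hι' := hι.smooth q.1
  have hκ' := hκ.contDiffAt_localFiberCoord hι ho (hg.isHermitianInner (ι q.1))
  have hne := hκ.ne_zero hι q.1
  set dX := mfderiv ((𝓡 n).prod 𝓘(ℝ, ℝ)) (modelK n) (coneMap ι κ) q X with hdX
  set dY := mfderiv ((𝓡 n).prod 𝓘(ℝ, ℝ)) (modelK n) (coneMap ι κ) q Y with hdY
  have hlag : kahlerForm g (coneMap ι κ q).proj dX.1 dY.1 = 0 :=
    (congrArg₂ (kahlerForm g (ι q.1)) (congrArg Prod.fst (mfderiv_coneMap hι' hκ' X))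
      (congrArg Prod.fst (mfderiv_coneMap hι' hκ' Y))).trans (hι.lagrangian q.1 X.1 Y.1)
  have hvert : ∀ a b c : ℂ, (a * b * conj (a * c)).im = Complex.normSq a * (b * conj c).im := by
    intro a b c
    rw [map_mul, mul_mul_mul_comm, Complex.mul_conj, Complex.im_ofReal_mul]
  rw [calabiForm_eq hg, hlag, hdX, hdY, vertPart_mfderiv_coneMap hι' hκ' hne,
    vertPart_mfderiv_coneMap hι' hκ' hne, hvert]
  change _ - 2 * t⁻¹ * _ * dzNormSq g (ι q.1) * _ = _
  ring

theorem IsVolumeSection.im_connCoeff_eq_zero {t : ℝ} (ht : t ≠ 0) {u : ℝ → ℝ}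
    (hu : ∀ s, 0 ≤ s → deriv u s ≠ 0)
    (h : IsSpecialLagrangian g t u ((𝓡 n).prod 𝓘(ℝ, ℝ)) (coneMap ι κ)) (l : L)
    (w : EuclideanSpace ℝ (Fin n)) : (connCoeff g ι κ l w).im = 0 := by
  have hpos := dzNormSq_pos (hg.isHermitianInner (ι l))
  have hscale : 2 * t⁻¹ * deriv u (rSq g (coneMap ι κ (l, 1))) * dzNormSq g (ι l) *
      Complex.normSq (fiberCoeff (κ l)) ≠ 0 :=
    mul_ne_zero (mul_ne_zero (mul_ne_zero (mul_ne_zero two_ne_zero (inv_ne_zero ht))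
      (hu _ (rSq_nonneg (hg.isHermitianInner _)))) hpos.ne')
      (Complex.normSq_pos.2 (hκ.ne_zero hι l)).ne'
  have hform := (hκ.calabiForm_coneMap (q := (l, 1)) hι ho hg t u (w, 0) (0, 1)).symm.trans
    (h.lagrangian (l, 1) _ _)
  have him := (mul_eq_zero.1 hform).resolve_left (neg_ne_zero.2 hscale)
  simpa [connCoeff_zero] using him

theorem IsVolumeSection.isSpecialLagrangian_coneMap_iff {t : ℝ} (ht : t ≠ 0) {u : ℝ → ℝ}
    (hu : ∀ s, 0 ≤ s → deriv u s ≠ 0) :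
    IsSpecialLagrangian g t u ((𝓡 n).prod 𝓘(ℝ, ℝ)) (coneMap ι κ) ↔
      ∀ l w, (connCoeff g ι κ l w).im = 0 := by
  have hcoord := fun l => hκ.contDiffAt_localFiberCoord hι ho (hg.isHermitianInner (ι l))
  refine ⟨hκ.im_connCoeff_eq_zero hι ho hg ht hu, fun h => ?_⟩
  exact {
    dim := by rw [finrank_prod, finrank_euclideanSpace_fin, finrank_self]
    smooth := fun q => contMDiffAt_coneMap (hι.smooth q.1) (hcoord q.1)
    immersion := fun q => mfderiv_coneMap_injective (hι.smooth q.1) (hcoord q.1)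
      (hι.immersion q.1) (hκ.ne_zero hι q.1)
    lagrangian := fun q X Y => (hκ.calabiForm_coneMap hι ho hg t u X Y).trans <|
      mul_eq_zero_of_right _ <| by simp [Complex.mul_im, h q.1]
    special := fun q X => hκ.im_holVolumeForm_coneMap hι ho (hg.isHermitianInner (ι q.1)) X }

end VolumeSection

end ConeForms

end

end MinLag

theorem lemma1_general {n : ℕ} {N : Type*} [TopologicalSpace N] [ChartedSpace (Cn n) N]
    [IsManifold 𝓘(ℂ, Cn n) ω N] {g : RMetric n N} (hg : IsKahler g) {t : ℝ} (ht : t ≠ 0)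
    {u : ℝ → ℝ} (hu : ∀ s, 0 ≤ s → deriv u s ≠ 0)
    {L : Type*} [TopologicalSpace L] [ChartedSpace (EuclideanSpace ℝ (Fin n)) L]
    [IsManifold (𝓡 n) ∞ L]
    {o : ∀ l : L, Orientation ℝ (TangentSpace (𝓡 n) l) (Fin n)} (ho : IsOrientation o)
    {ι : L → N} (hι : IsLagrangian g ι) :
    ∃ κ : ∀ l, CanonicalFiber n N (ι l),
      (∀ l a, RestrictsToVolume g ι o l a ↔ a = κ l) ∧
      (Topology.IsEmbedding ι → Topology.IsEmbedding (coneMap ι κ)) ∧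
      (IsMinimal g ι ↔ IsSpecialLagrangian g t u ((𝓡 n).prod 𝓘(ℝ, ℝ)) (coneMap ι κ)) := by
  have hherm := fun l => hg.isHermitianInner (ι l)
  obtain ⟨κ, hκ⟩ := exists_isVolumeSection o hherm hι
  have hcoord := fun l => hκ.contDiffAt_localFiberCoord hι ho (hherm l)
  refine ⟨κ, restrictsToVolume_iff hherm hι hκ, fun hemb => ?_, ?_⟩
  · exact isEmbedding_coneMap hemb (hκ.ne_zero hι)
      (fun l => (contMDiffAt_fiberCoord (hcoord l)).continuousAt)
      (ContMDiff.continuous fun q => contMDiffAt_coneMap (hι.smooth q.1) (hcoord q.1))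
  · rw [isMinimal_iff hg hι ho hκ, hκ.isSpecialLagrangian_coneMap_iff hι ho hg ht hu]

theorem lemma1 {n : ℕ} {N : Type*} [TopologicalSpace N] [ChartedSpace (Cn n) N]
    [IsManifold 𝓘(ℂ, Cn n) ω N] (g : RMetric n N) (t : ℝ) (ht : 0 < t) (hg : IsKahlerEinstein g t)
    (c : ℝ) (hc : 0 < c)
    {L : Type*} [TopologicalSpace L] [ChartedSpace (EuclideanSpace ℝ (Fin n)) L]
    [IsManifold (𝓡 n) ∞ L]
    (o : ∀ l : L, Orientation ℝ (TangentSpace (𝓡 n) l) (Fin n)) (ho : IsOrientation o)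
    (ι : L → N) (hι : IsLagrangian g ι) :
    ∃ κ : ∀ l, CanonicalFiber n N (ι l),
      (∀ l a, RestrictsToVolume g ι o l a ↔ a = κ l) ∧
      (Topology.IsEmbedding ι → Topology.IsEmbedding (coneMap ι κ)) ∧
      (IsMinimal g ι ↔
        IsSpecialLagrangian g t (calabiProfile n t c) ((𝓡 n).prod 𝓘(ℝ, ℝ)) (coneMap ι κ)) :=
  lemma1_general hg.isKahler ht.ne' (fun _ hs => (deriv_calabiProfile_pos n ht hc hs).ne') ho hι
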